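/- Let $G$ be a (discrete) group and let $1<p<\infty$. Let $A=\ell^1(G)$ be the Banach algebra with the convolution product, and regard $\ell^p(G)$ as a Banach left $A$-module with the product $(f\cdot g)(s)=\sum_{t\in G}f(t)\,g(t^{-1}s)$ ($f\in \ell^1(G)$, $g\in\ell^p(G)$, $s\in G$). Then $\ell^p(G)$ is injective in the category of Banach left $A$-modules if and only if $G$ is $(p,p)$-amenable. Here all spaces are complex. A Banach left $A$-module is a Banach space $E$ that is a left $A$-module with a bounded bilinear product $A\times E\to E$, and morphisms are bounded linear $A$-module maps. A Banach left $A$-module $J$ is *injective* if for all Banach left $A$-modules $E,F$, each morphism $T:E\to F$ that has a bounded linear left inverse, and each morphism $S:E\to J$, there is a morphism $R:F\to J$ with $R\circ T=S$. For a Banach space $E$ with dual $E'$, $n\in\mathbb{N}$, $x=(x_1,\dots,x_n)\in E^n$ and $1\le p\le q<\infty$ put $\mu_{p,n}(x)=\sup\{(\sum_{i=1}^n|\langle x_i,\lambda\rangle|^p)^{1/p}:\lambda\in E',\ \|\lambda\|\le 1\}$; the *weak $(p,q)$-multi-norm* over $E$ is the sequence of norms $$\|x\|_n^{(p,q)}=\sup\Big\{\Big(\sum_{i=1}^n|\langle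 x_i,\lambda_i\rangle|^q\Big)^{1/q}:\lambda=(\lambda_1,\dots,\lambda_n)\in (E')^n,\ \mu_{p,n}(\lambda)\le 1\Big\}\qquad(n\in\mathbb{N}),$$ and a set $B\subset E$ is *multi-bounded* for it if $\sup\{\|(x_1,\dots,x_n)\|_n^{(p,q)}: n\in\mathbb{N},\ x_1,\dots,x_n\in B\}<\infty$. For $s\in G$ and $f\in\ell^1(G)$ let $(s\cdot f)(t)=f(s^{-1}t)$, and extend this action to the second dual $\ell^1(G)''$ by taking second adjoints. A *mean* is an element $\Lambda\in\ell^1(G)''$ with $\langle 1,\Lambda\rangle=\|\Lambda\|=1$, where $1\in\ell^\infty(G)=\ell^1(G)'$ is the constant function. The group $G$ is *$(p,q)$-amenable* if there is a mean $\Lambda\in\ell^1(G)''$ such that $\{s\cdot\Lambda:s\in G\}$ is multi-bounded for the weak $(p,q)$-multi-norm over $\ell^1(G)''$. -/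

import Mathlib

open scoped ENNReal lp

universe u

noncomputable section

/-! ## Banach left modules and injectivity -/

/-- A Banach left module structure over the Banach algebra `A` on the Banach space `E`:
a bounded bilinear map `A × E → E`, `(a, x) ↦ a · x`, with `(a b) · x = a · (b · x)`. -/
structure BanachLeftModule (A : Type*) [NonUnitalNormedRing A] [NormedSpace ℂ A]
    [IsScalarTower ℂ A A] [SMulCommClass ℂ A A] [CompleteSpace A]
    (E : Type*) [NormedAddCommGroup E] [NormedSpace ℂ E] where
  act : A →L[ℂ] E →L[ℂ] E
  act_mul : ∀ (a b : A) (x : E), act (a * b) x = act a (act b x)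

namespace BanachLeftModule

variable {A : Type*} [NonUnitalNormedRing A] [NormedSpace ℂ A]
  [IsScalarTower ℂ A A] [SMulCommClass ℂ A A] [CompleteSpace A]
  {E : Type*} [NormedAddCommGroup E] [NormedSpace ℂ E]
  {F : Type*} [NormedAddCommGroup F] [NormedSpace ℂ F]

/-- The bounded linear map `T : E → F` is a morphism of left `A`-modules. -/
def IsMorphism (ME : BanachLeftModule A E) (MF : BanachLeftModule A F) (T : E →L[ℂ] F) : Prop :=
  ∀ (a : A) (x : E), T (ME.act a x) = MF.act a (T x)

/-- Injectivity of a Banach left `A`-module `J` (modules live in one fixed universe `u`):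
every morphism `S : E → J` extends along every admissible monomorphism `T : E → F`, that is,
every morphism `T` having a bounded linear left inverse. -/
def IsInjective {A : Type u} [NonUnitalNormedRing A] [NormedSpace ℂ A]
    [IsScalarTower ℂ A A] [SMulCommClass ℂ A A] [CompleteSpace A]
    {J : Type u} [NormedAddCommGroup J] [NormedSpace ℂ J] (MJ : BanachLeftModule A J) : Prop :=
  ∀ (E F : Type u) [NormedAddCommGroup E] [NormedSpace ℂ E] [CompleteSpace E]
    [NormedAddCommGroup F] [NormedSpace ℂ F] [CompleteSpace F]
    (ME : BanachLeftModule A E) (MF : BanachLeftModule A F) (T : E →L[ℂ] F) (S : E →L[ℂ] J),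
    ME.IsMorphism MF T →
    (∃ V : F →L[ℂ] E, V ∘L T = ContinuousLinearMap.id ℂ E) →
    ME.IsMorphism MJ S →
    ∃ R : F →L[ℂ] J, MF.IsMorphism MJ R ∧ R ∘L T = S

end BanachLeftModule

/-! ## The weak `(p, q)`-multi-norm -/

section MultiNorm

variable {E : Type*} [NormedAddCommGroup E] [NormedSpace ℂ E]

/-- The weak `p`-summing norm `μ_{p,n}` on `E ^ n`: the supremum of `(∑ |⟨x_i, l⟩| ^ p) ^ (1/p)`
over the functionals `l` in the closed unit ball of the dual space. -/
def weakSummingNorm (p : ℝ) {n : ℕ} (x : Fin n → E) : ℝ :=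
  ⨆ l : {l : StrongDual ℂ E // ‖l‖ ≤ 1}, (∑ i, ‖l.1 (x i)‖ ^ p) ^ (1 / p)

/-- The `n`-th weak `(p, q)`-multi-norm on `E ^ n`: the supremum of
`(∑ |⟨x_i, l_i⟩| ^ q) ^ (1/q)` over the tuples `l` of functionals with `μ_{p,n}(l) ≤ 1`. -/
def weakMultiNorm (p q : ℝ) {n : ℕ} (x : Fin n → E) : ℝ :=
  ⨆ l : {l : Fin n → StrongDual ℂ E // weakSummingNorm p l ≤ 1},
    (∑ i, ‖l.1 i (x i)‖ ^ q) ^ (1 / q)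

lemma rpow_sum_le_of_norm_le {ι : Type*} [Fintype ι] {p : ℝ} (hp : 1 ≤ p) {a b : ι → ℝ}
    (ha : ∀ i, 0 ≤ a i) (hab : ∀ i, a i ≤ b i) :
    (∑ i, a i ^ p) ^ (1 / p) ≤ (∑ i, b i ^ p) ^ (1 / p) := by
  have hp0 : 0 ≤ p := zero_le_one.trans hp
  refine Real.rpow_le_rpow (Finset.sum_nonneg fun i _ => Real.rpow_nonneg (ha i) _) ?_
    (by positivity)
  exact Finset.sum_le_sum fun i _ => Real.rpow_le_rpow (ha i) (hab i) hp0

/-- The supremum in `weakSummingNorm` is a genuine (finite) one. -/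
lemma bddAbove_weakSummingNorm {p : ℝ} (hp : 1 ≤ p) {n : ℕ} (x : Fin n → E) :
    BddAbove (Set.range fun l : {l : StrongDual ℂ E // ‖l‖ ≤ 1} =>
      (∑ i, ‖l.1 (x i)‖ ^ p) ^ (1 / p)) := by
  refine ⟨(∑ i, ‖x i‖ ^ p) ^ (1 / p), ?_⟩
  rintro _ ⟨l, rfl⟩
  refine rpow_sum_le_of_norm_le hp (fun _ => norm_nonneg _) fun i => ?_
  exact (l.1.le_of_opNorm_le l.2 (x i)).trans (by rw [one_mul])

lemma norm_le_weakSummingNorm {p : ℝ} (hp : 1 ≤ p) {n : ℕ} (x : Fin n → E) (i : Fin n) :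
    ‖x i‖ ≤ weakSummingNorm p x := by
  have hp0 : p ≠ 0 := by linarith
  obtain ⟨l, hl, hx⟩ := exists_dual_vector'' ℂ (x i)
  refine le_trans ?_ (le_ciSup (bddAbove_weakSummingNorm hp x) ⟨l, hl⟩)
  have h1 : ‖x i‖ = (‖l (x i)‖ ^ p) ^ (1 / p) := by
    rw [one_div, Real.rpow_rpow_inv (norm_nonneg _) hp0, hx]
    simp
  rw [h1]
  refine Real.rpow_le_rpow (Real.rpow_nonneg (norm_nonneg _) _) ?_ (by positivity)
  exact Finset.single_le_sum (f := fun j => ‖l (x j)‖ ^ p)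
    (fun j _ => Real.rpow_nonneg (norm_nonneg _) _) (Finset.mem_univ i)

/-- The supremum in `weakMultiNorm` is a genuine (finite) one. -/
lemma bddAbove_weakMultiNorm {p q : ℝ} (hp : 1 ≤ p) (hq : 1 ≤ q) {n : ℕ} (x : Fin n → E) :
    BddAbove (Set.range fun l : {l : Fin n → StrongDual ℂ E // weakSummingNorm p l ≤ 1} =>
      (∑ i, ‖l.1 i (x i)‖ ^ q) ^ (1 / q)) := by
  refine ⟨(∑ i, ‖x i‖ ^ q) ^ (1 / q), ?_⟩
  rintro _ ⟨l, rfl⟩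
  refine rpow_sum_le_of_norm_le hq (fun _ => norm_nonneg _) fun i => ?_
  exact ((l.1 i).le_of_opNorm_le ((norm_le_weakSummingNorm hp l.1 i).trans l.2) (x i)).trans
    (by rw [one_mul])

/-- A subset `B` of `E` is multi-bounded for the weak `(p, q)`-multi-norm: the norms of all finite
tuples of elements of `B` are bounded by one constant. -/
def IsWeakMultiBounded (p q : ℝ) (B : Set E) : Prop :=
  ∃ C : ℝ, ∀ (n : ℕ) (x : Fin n → E), (∀ i, x i ∈ B) → weakMultiNorm p q x ≤ C

end MultiNorm

/-! ## Translation and convolution on `ℓ^p(G)` -/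

section Group

lemma summable_norm_ellOne {G : Type u} (f : ℓ¹(G, ℂ)) : Summable fun t => ‖f t‖ := by
  simpa using (lp.memℓp f).summable (by simp)

lemma norm_ellOne {G : Type u} (f : ℓ¹(G, ℂ)) : ‖f‖ = ∑' t, ‖f t‖ := by
  simpa using lp.norm_eq_tsum_rpow (p := 1) (by simp) f

variable {G : Type u} [Group G]

section Translation

variable (p : ℝ≥0∞) [Fact (1 ≤ p)]

lemma memℓp_translate (t : G) (g : ℓ^p(G, ℂ)) : Memℓp (fun s => g (t⁻¹ * s)) p := by
  rcases eq_or_ne p ∞ with rfl | hp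
  · refine memℓp_infty ⟨‖g‖, ?_⟩
    rintro _ ⟨s, rfl⟩
    exact lp.norm_apply_le_norm ENNReal.top_ne_zero g _
  · have h0 : 0 < p.toReal := ENNReal.toReal_pos (zero_lt_one.trans_le Fact.out).ne' hp
    exact memℓp_gen (((lp.memℓp g).summable h0).comp_injective (mul_right_injective t⁻¹))

/-- Left translation on `ℓ^p(G)`: `(t · g)(s) = g(t⁻¹ s)`. -/
def lpTranslate (t : G) : ℓ^p(G, ℂ) →L[ℂ] ℓ^p(G, ℂ) :=
  LinearMap.mkContinuous
    { toFun := fun g => ⟨fun s => g (t⁻¹ * s), memℓp_translate p t g⟩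
      map_add' := fun _ _ => rfl
      map_smul' := fun _ _ => rfl }
    1 (fun g => by
      rw [one_mul]
      rcases eq_or_ne p ∞ with rfl | hp
      · exact lp.norm_le_of_forall_le (norm_nonneg _) fun s =>
          lp.norm_apply_le_norm ENNReal.top_ne_zero g _
      · have h0 : 0 < p.toReal := ENNReal.toReal_pos (zero_lt_one.trans_le Fact.out).ne' hp
        refine lp.norm_le_of_tsum_le h0 (norm_nonneg _) ?_
        rw [lp.norm_rpow_eq_tsum h0 g]
        exact ((Equiv.mulLeft t⁻¹).tsum_eq fun s => ‖g s‖ ^ p.toReal).le)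

variable {p}

@[simp] lemma lpTranslate_apply (t : G) (g : ℓ^p(G, ℂ)) (s : G) :
    lpTranslate p t g s = g (t⁻¹ * s) := rfl

lemma norm_lpTranslate_le (t : G) (g : ℓ^p(G, ℂ)) : ‖lpTranslate p t g‖ ≤ ‖g‖ := by
  have h : ‖(lpTranslate p t : ℓ^p(G, ℂ) →L[ℂ] ℓ^p(G, ℂ))‖ ≤ 1 :=
    LinearMap.mkContinuous_norm_le _ zero_le_one _
  simpa using (lpTranslate p t).le_of_opNorm_le h g

lemma lpTranslate_mul (t u : G) (g : ℓ^p(G, ℂ)) :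
    lpTranslate p (t * u) g = lpTranslate p t (lpTranslate p u g) := by
  refine lp.ext (funext fun s => ?_)
  simp [mul_assoc]

lemma summable_conv_norm (f : ℓ¹(G, ℂ)) (g : ℓ^p(G, ℂ)) :
    Summable fun t => ‖f t • lpTranslate p t g‖ := by
  refine ((summable_norm_ellOne f).mul_right ‖g‖).of_nonneg_of_le (fun _ => norm_nonneg _) ?_
  intro t
  rw [norm_smul]
  exact mul_le_mul_of_nonneg_left (norm_lpTranslate_le t g) (norm_nonneg _)

lemma summable_conv (f : ℓ¹(G, ℂ)) (g : ℓ^p(G, ℂ)) :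
    Summable fun t => f t • lpTranslate p t g :=
  (summable_conv_norm f g).of_norm

lemma conv_eq_coe_tsum (f : ℓ¹(G, ℂ)) (g : ℓ^p(G, ℂ)) :
    (fun s => ∑' t, f t * g (t⁻¹ * s)) =
      ((∑' t, f t • lpTranslate p t g : ℓ^p(G, ℂ)) : G → ℂ) := by
  funext s
  have h := (lp.evalCLM ℂ (fun _ : G => ℂ) p s).map_tsum (summable_conv f g)
  exact h.symm

/-- The convolution `(f ⋆ g)(s) = ∑ t, f(t) g(t⁻¹ s)` of `f ∈ ℓ¹(G)` and `g ∈ ℓ^p(G)`. -/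
def lpConv (f : ℓ¹(G, ℂ)) (g : ℓ^p(G, ℂ)) : ℓ^p(G, ℂ) :=
  ⟨fun s => ∑' t, f t * g (t⁻¹ * s), by rw [conv_eq_coe_tsum]; exact lp.memℓp _⟩

lemma lpConv_apply (f : ℓ¹(G, ℂ)) (g : ℓ^p(G, ℂ)) (s : G) :
    lpConv f g s = ∑' t, f t * g (t⁻¹ * s) := rfl

lemma lpConv_eq_tsum (f : ℓ¹(G, ℂ)) (g : ℓ^p(G, ℂ)) :
    lpConv f g = ∑' t, f t • lpTranslate p t g :=
  lp.ext (conv_eq_coe_tsum f g)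

lemma norm_lpConv_le (f : ℓ¹(G, ℂ)) (g : ℓ^p(G, ℂ)) : ‖lpConv f g‖ ≤ ‖f‖ * ‖g‖ := by
  rw [lpConv_eq_tsum, norm_ellOne, ← tsum_mul_right]
  refine (norm_tsum_le_tsum_norm (summable_conv_norm f g)).trans ?_
  refine (summable_conv_norm f g).tsum_le_tsum (fun t => ?_)
    ((summable_norm_ellOne f).mul_right ‖g‖)
  rw [norm_smul]
  exact mul_le_mul_of_nonneg_left (norm_lpTranslate_le t g) (norm_nonneg _)

lemma lpConv_add_left (f f' : ℓ¹(G, ℂ)) (g : ℓ^p(G, ℂ)) :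
    lpConv (f + f') g = lpConv f g + lpConv f' g := by
  simp only [lpConv_eq_tsum]
  rw [← (summable_conv f g).tsum_add (summable_conv f' g)]
  exact tsum_congr fun t => add_smul _ _ _

lemma lpConv_smul_left (c : ℂ) (f : ℓ¹(G, ℂ)) (g : ℓ^p(G, ℂ)) :
    lpConv (c • f) g = c • lpConv f g := by
  simp only [lpConv_eq_tsum]
  rw [← (summable_conv f g).tsum_const_smul c]
  exact tsum_congr fun t => smul_assoc c (f t) _

lemma lpConv_add_right (f : ℓ¹(G, ℂ)) (g g' : ℓ^p(G, ℂ)) :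
    lpConv f (g + g') = lpConv f g + lpConv f g' := by
  simp only [lpConv_eq_tsum]
  rw [← (summable_conv f g).tsum_add (summable_conv f g')]
  exact tsum_congr fun t => by rw [map_add, smul_add]

lemma lpConv_smul_right (c : ℂ) (f : ℓ¹(G, ℂ)) (g : ℓ^p(G, ℂ)) :
    lpConv f (c • g) = c • lpConv f g := by
  simp only [lpConv_eq_tsum]
  rw [← (summable_conv f g).tsum_const_smul c]
  exact tsum_congr fun t => by rw [map_smul, smul_comm]

/-- Convolution as a bounded bilinear map `ℓ¹(G) × ℓ^p(G) → ℓ^p(G)`. -/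
def lpConvL (G : Type u) [Group G] (p : ℝ≥0∞) [Fact (1 ≤ p)] :
    ℓ¹(G, ℂ) →L[ℂ] ℓ^p(G, ℂ) →L[ℂ] ℓ^p(G, ℂ) :=
  LinearMap.mkContinuous₂
    (LinearMap.mk₂ ℂ lpConv lpConv_add_left lpConv_smul_left lpConv_add_right lpConv_smul_right)
    1 (fun f g => by rw [one_mul]; exact norm_lpConv_le f g)

@[simp] lemma lpConvL_apply (f : ℓ¹(G, ℂ)) (g : ℓ^p(G, ℂ)) : lpConvL G p f g = lpConv f g := rfl

lemma lpConv_lpTranslate (t : G) (f : ℓ¹(G, ℂ)) (h : ℓ^p(G, ℂ)) :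
    lpConv (lpTranslate 1 t f) h = lpTranslate p t (lpConv f h) := by
  rw [lpConv_eq_tsum, lpConv_eq_tsum, (lpTranslate p t).map_tsum (summable_conv f h),
    ← (Equiv.mulLeft t).tsum_eq]
  refine tsum_congr fun u => ?_
  simp [lpTranslate_mul]

lemma lpConv_assoc (f g : ℓ¹(G, ℂ)) (h : ℓ^p(G, ℂ)) :
    lpConv (lpConv f g) h = lpConv f (lpConv g h) := by
  have e : lpConv (lpConv f g) h = (lpConvL G p).flip h (lpConv f g) := rfl
  rw [e, lpConv_eq_tsum f g, ((lpConvL G p).flip h).map_tsum (summable_conv f g),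
    lpConv_eq_tsum f]
  refine tsum_congr fun t => ?_
  rw [map_smul, ContinuousLinearMap.flip_apply, lpConvL_apply, lpConv_lpTranslate]

end Translation

/-- The Banach algebra `ℓ¹(G)`, with the convolution product. -/
instance ellOneNonUnitalNormedRing : NonUnitalNormedRing ℓ¹(G, ℂ) where
  __ := (inferInstance : NormedAddCommGroup ℓ¹(G, ℂ))
  mul := lpConv
  left_distrib := lpConv_add_right
  right_distrib := lpConv_add_left
  zero_mul g := ((lpConvL G 1).flip g).map_zero
  mul_zero f := (lpConvL G 1 f).map_zero
  mul_assoc := lpConv_assoc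
  norm_mul_le := norm_lpConv_le

lemma ellOne_mul_apply (f g : ℓ¹(G, ℂ)) (s : G) : (f * g) s = ∑' t, f t * g (t⁻¹ * s) := rfl

instance ellOneIsScalarTower : IsScalarTower ℂ ℓ¹(G, ℂ) ℓ¹(G, ℂ) :=
  ⟨fun c f g => lpConv_smul_left c f g⟩

instance ellOneSMulCommClass : SMulCommClass ℂ ℓ¹(G, ℂ) ℓ¹(G, ℂ) :=
  ⟨fun c f g => (lpConv_smul_right c f g).symm⟩

/-- The Banach left `ℓ¹(G)`-module `ℓ^p(G)`, with module product the convolution. -/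
def ellModule (G : Type u) [Group G] (p : ℝ≥0∞) [Fact (1 ≤ p)] :
    BanachLeftModule ℓ¹(G, ℂ) ℓ^p(G, ℂ) where
  act := lpConvL G p
  act_mul := lpConv_assoc

/-! ## `(p, q)`-amenability -/

/-- The second dual of `ℓ¹(G)`. -/
abbrev EllOneBidual (G : Type u) : Type u := StrongDual ℂ (StrongDual ℂ ℓ¹(G, ℂ))

/-- `L` is a mean on `G`: `⟨1, L⟩ = ‖L‖ = 1`, where the constant function `1` is viewed as the
functional `f ↦ ∑ t, f(t)` in the dual of `ℓ¹(G)`. -/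
def IsMean (L : EllOneBidual G) : Prop :=
  L (lp.tsumCLM ℂ G ℂ) = 1 ∧ ‖L‖ = 1

/-- The action of `G` on the second dual of `ℓ¹(G)`, the second adjoint of left translation:
`⟨l, s · L⟩ = ⟨l ∘ (left translation by s), L⟩`. -/
def bidualTranslate (s : G) (L : EllOneBidual G) : EllOneBidual G :=
  L ∘L (ContinuousLinearMap.compL ℂ ℓ¹(G, ℂ) ℓ¹(G, ℂ) ℂ).flip (lpTranslate 1 s)

lemma bidualTranslate_apply (s : G) (L : EllOneBidual G) (l : StrongDual ℂ ℓ¹(G, ℂ)) :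
    bidualTranslate s L l = L (l ∘L lpTranslate 1 s) := rfl

/-- The (discrete) group `G` is `(p, q)`-amenable: there is a mean `L` on `G` whose orbit
`{s · L : s ∈ G}` is multi-bounded for the weak `(p, q)`-multi-norm on the second dual. -/
def IsPQAmenable (G : Type u) [Group G] (p q : ℝ) : Prop :=
  ∃ L : EllOneBidual G, IsMean L ∧
    IsWeakMultiBounded p q (Set.range fun s : G => bidualTranslate s L)

end Group

end

/-!
# Injectivity of `ℓ^p(G)` and `(p, p)`-amenability

A bounded function on `G` is a functional on `ℓ¹(G)`, determined by its values at the point masses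
`lpDelta 1 t`. Both directions rest on the same correspondence: a functional `L` on the bounded
functions acts on bounded families `U t ∈ ℓ^p(G)` by `r ↦ ⟨U(·)(r), r · L⟩`, and the
`(p, p)`-multi-norm estimate for the orbit of `L` says that this lands boundedly in `ℓ^p(G)`.

*Amenable implies injective.* Given `T : E → F` with left inverse `V` and `S : E → ℓ^p(G)`, the
family `w t y = t · S (V (t⁻¹ · y))` is constant, equal to `S x`, when `y = T x`. Evaluating it along
the orbit of the mean (`exists_orbit_evaluation`) yields the extension of `S`; equivariance is a
change of variables.

*Injective implies amenable.* Injectivity splits the embedding of `ℓ^p(G)` into the operators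
`ℓ¹(G) → ℓ^p(G)` by an equivariant `Q` (`exists_equivariant_splitting`). Then
`M f = Q(f ⊗ δ₁)(1)` has `M 1 = 1`, and by equivariance `(s · M) f = Q(f ⊗ δ_s)(s)` is a diagonal
entry of `Q`. The diagonal of `Q` is bounded by `‖Q‖` (`sum_norm_diagonal_le`), which gives the
`ℓ^p`-estimate for the orbit of `M` on tuples of bounded functions. Two things remain. The functional
`M` is not a mean, but it dominates one up to a factor `2` (`exists_isMean_dominated`, by
Hahn–Banach). And the multi-norm on the second dual of `ℓ¹(G)` tests against the third dual rather
than against bounded functions; the passage between the two is a finite-dimensional form of local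
reflexivity (`weakMultiNorm_dual_le`).
-/

/-! ### The dual ball of a finite-dimensional `ℓ^p` -/

section DualBall

variable {ι : Type*} [Fintype ι] {p : ℝ}

/-- The closed unit ball of `ℓ^{p'}(ι)`, `1/p + 1/p' = 1`, described by duality: the vectors `α`
for which `v ↦ ∑ i, α i * v i` is a contraction on `ℓ^p(ι)`. -/
def lpDualBall (ι : Type*) [Fintype ι] (p : ℝ) : Set (ι → ℂ) :=
  {α | ∀ v : ι → ℂ, ‖∑ i, α i * v i‖ ≤ (∑ i, ‖v i‖ ^ p) ^ (1 / p)}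

lemma exists_mem_lpDualBall (hp : 1 ≤ p) (v : ι → ℂ) :
    ∃ α ∈ lpDualBall ι p, ∑ i, α i * v i = (((∑ i, ‖v i‖ ^ p) ^ (1 / p) : ℝ) : ℂ) := by
  classical
  have hp0 : 0 < p := by linarith
  have hr : (ENNReal.ofReal p).toReal = p := ENNReal.toReal_ofReal hp0.le
  have : Fact (1 ≤ ENNReal.ofReal p) := ⟨by simpa using ENNReal.ofReal_le_ofReal hp⟩
  have hnorm (w : ι → ℂ) :
      ‖WithLp.toLp (ENNReal.ofReal p) w‖ = (∑ i, ‖w i‖ ^ p) ^ (1 / p) := by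
    rw [PiLp.norm_eq_sum (by rw [hr]; exact hp0), hr]
  obtain ⟨g, hg, hgv⟩ := exists_dual_vector'' ℂ (WithLp.toLp (ENNReal.ofReal p) v)
  have hsum (w : ι → ℂ) :
      ∑ i, g (WithLp.toLp _ (Pi.single i 1)) * w i = g (WithLp.toLp _ w) := by
    have hw : WithLp.toLp (ENNReal.ofReal p) w =
        ∑ i, w i • WithLp.toLp (ENNReal.ofReal p) (Pi.single i (1 : ℂ)) := by
      ext j
      simp [Pi.single_apply]
    rw [hw, map_sum]
    exact Finset.sum_congr rfl fun i _ => by rw [map_smul, smul_eq_mul, mul_comm]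
  refine ⟨fun i => g (WithLp.toLp _ (Pi.single i 1)), fun w => ?_, ?_⟩
  · rw [hsum, ← hnorm]
    simpa using g.le_of_opNorm_le hg (WithLp.toLp _ w)
  · rw [hsum, hgv, hnorm]
    rfl

lemma norm_le_rpow_sum_norm (hp : 1 ≤ p) (v : ι → ℂ) (i : ι) :
    ‖v i‖ ≤ (∑ j, ‖v j‖ ^ p) ^ (1 / p) := by
  have hp0 : 0 < p := by linarith
  rw [one_div, Real.le_rpow_inv_iff_of_pos (norm_nonneg _)
    (Finset.sum_nonneg fun j _ => Real.rpow_nonneg (norm_nonneg _) _) hp0]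
  exact Finset.single_le_sum (f := fun j => ‖v j‖ ^ p)
    (fun j _ => Real.rpow_nonneg (norm_nonneg _) _) (Finset.mem_univ i)

lemma norm_apply_le_one_of_mem_lpDualBall (hp : 1 ≤ p) {α : ι → ℂ} (hα : α ∈ lpDualBall ι p)
    (i : ι) : ‖α i‖ ≤ 1 := by
  classical
  have hp0 : p ≠ 0 := by linarith
  have h := hα (Pi.single i 1)
  have h1 : ∑ j, ‖(Pi.single i (1 : ℂ) : ι → ℂ) j‖ ^ p = 1 := by
    rw [Finset.sum_eq_single i]
    · simp
    · intro j _ hj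
      simp [Pi.single_eq_of_ne hj, Real.zero_rpow hp0]
    · simp
  rw [h1] at h
  simpa [Pi.single_apply] using h

/-- The ball `lpDualBall` is compact, so it has a finite `1/2`-net for the norm of `ℓ^{p'}(ι)`. -/
lemma exists_half_net_lpDualBall (hp : 1 ≤ p) :
    ∃ A : Finset (ι → ℂ), (∀ α ∈ A, α ∈ lpDualBall ι p) ∧
      ∀ β ∈ lpDualBall ι p, ∃ α ∈ A, ∀ v : ι → ℂ,
        ‖∑ i, (β i - α i) * v i‖ ≤ 1 / 2 * (∑ i, ‖v i‖ ^ p) ^ (1 / p) := by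
  have hsub : lpDualBall ι p ⊆ Metric.closedBall 0 1 := fun α hα => by
    rw [mem_closedBall_zero_iff, pi_norm_le_iff_of_nonneg zero_le_one]
    exact norm_apply_le_one_of_mem_lpDualBall hp hα
  have htb : TotallyBounded (lpDualBall ι p) :=
    (isCompact_closedBall (0 : ι → ℂ) 1).totallyBounded.subset hsub
  set ε : ℝ := 1 / (2 * (Fintype.card ι + 1)) with hε
  have hε0 : 0 < ε := by positivity
  obtain ⟨t, hts, htf, hcov⟩ := Metric.finite_approx_of_totallyBounded htb ε hε0
  refine ⟨htf.toFinset, fun α hα => hts (htf.mem_toFinset.1 hα), fun β hβ => ?_⟩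
  obtain ⟨α, hα, hβα⟩ := Set.mem_iUnion₂.1 (hcov hβ)
  refine ⟨α, htf.mem_toFinset.2 hα, fun v => ?_⟩
  have hN : 0 ≤ (∑ i, ‖v i‖ ^ p) ^ (1 / p) :=
    Real.rpow_nonneg (Finset.sum_nonneg fun j _ => Real.rpow_nonneg (norm_nonneg _) _) _
  have hd (i : ι) : ‖β i - α i‖ ≤ ε := by
    have := (dist_pi_lt_iff hε0).1 (Metric.mem_ball.1 hβα) i
    rw [dist_eq_norm] at this
    exact this.le
  calc ‖∑ i, (β i - α i) * v i‖ ≤ ∑ _i : ι, ε * (∑ i, ‖v i‖ ^ p) ^ (1 / p) := by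
        refine norm_sum_le_of_le _ fun i _ => ?_
        rw [norm_mul]
        exact mul_le_mul (hd i) (norm_le_rpow_sum_norm hp v i) (norm_nonneg _) hε0.le
    _ = (Fintype.card ι * ε) * (∑ i, ‖v i‖ ^ p) ^ (1 / p) := by
        rw [Finset.sum_const, Finset.card_univ, nsmul_eq_mul, mul_assoc]
    _ ≤ 1 / 2 * (∑ i, ‖v i‖ ^ p) ^ (1 / p) := by
        refine mul_le_mul_of_nonneg_right ?_ hN
        rw [hε, mul_one_div, div_le_div_iff₀ (by positivity) (by positivity)]
        linarith

end DualBall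

/-! ### Weak summing norms and the second dual -/

section WeakSumming

lemma rpow_sum_mul {ι : Type*} [Fintype ι] {p : ℝ} (hp : 1 ≤ p) {c : ℝ} (hc : 0 ≤ c) {a : ι → ℝ}
    (ha : ∀ i, 0 ≤ a i) : (∑ i, (c * a i) ^ p) ^ (1 / p) = c * (∑ i, a i ^ p) ^ (1 / p) := by
  have hp0 : p ≠ 0 := by linarith
  have h : ∑ i, (c * a i) ^ p = c ^ p * ∑ i, a i ^ p := by
    rw [Finset.mul_sum]
    exact Finset.sum_congr rfl fun i _ => Real.mul_rpow hc (ha i)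
  rw [h, Real.mul_rpow (Real.rpow_nonneg hc _)
    (Finset.sum_nonneg fun i _ => Real.rpow_nonneg (ha i) _), one_div,
    Real.rpow_rpow_inv hc hp0]

variable {X : Type*} [NormedAddCommGroup X] [NormedSpace ℂ X] {p : ℝ} {n : ℕ}

lemma weakSummingNorm_le {x : Fin n → X} {C : ℝ} (hp : 1 ≤ p)
    (h : ∀ α ∈ lpDualBall (Fin n) p, ‖∑ i, α i • x i‖ ≤ C) : weakSummingNorm p x ≤ C := by
  have : Nonempty {l : StrongDual ℂ X // ‖l‖ ≤ 1} := ⟨⟨0, by simp⟩⟩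
  refine ciSup_le fun l => ?_
  obtain ⟨α, hα, hαv⟩ := exists_mem_lpDualBall hp fun i => l.1 (x i)
  have h1 : l.1 (∑ i, α i • x i) = (((∑ i, ‖l.1 (x i)‖ ^ p) ^ (1 / p) : ℝ) : ℂ) := by
    rw [← hαv, map_sum]
    exact Finset.sum_congr rfl fun i _ => by rw [map_smul, smul_eq_mul]
  have h2 := l.1.le_of_opNorm_le l.2 (∑ i, α i • x i)
  rw [h1, one_mul, Complex.norm_real] at h2
  exact (le_abs_self _).trans (h2.trans (h α hα))

lemma rpow_sum_le_weakSummingNorm (hp : 1 ≤ p) (x : Fin n → X) {l : StrongDual ℂ X}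
    (hl : ‖l‖ ≤ 1) : (∑ i, ‖l (x i)‖ ^ p) ^ (1 / p) ≤ weakSummingNorm p x :=
  le_ciSup (bddAbove_weakSummingNorm hp x) ⟨l, hl⟩

lemma weakSummingNorm_nonneg (x : Fin n → X) : 0 ≤ weakSummingNorm p x :=
  Real.iSup_nonneg fun _ => Real.rpow_nonneg
    (Finset.sum_nonneg fun _ _ => Real.rpow_nonneg (norm_nonneg _) _) _

lemma norm_sum_smul_le_weakSummingNorm (hp : 1 ≤ p) (x : Fin n → X) {α : Fin n → ℂ}
    (hα : α ∈ lpDualBall (Fin n) p) : ‖∑ i, α i • x i‖ ≤ weakSummingNorm p x := by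
  obtain ⟨l, hl, hx⟩ := exists_dual_vector'' ℂ (∑ i, α i • x i)
  have h1 : ‖∑ i, α i • x i‖ = ‖∑ i, α i * l (x i)‖ := by
    rw [← RCLike.norm_coe_norm (𝕜 := ℂ) (z := ∑ i, α i • x i), ← hx, map_sum]
    simp
  rw [h1]
  exact (hα fun i => l (x i)).trans (rpow_sum_le_weakSummingNorm hp x hl)

lemma weakSummingNorm_smul_le (hp : 1 ≤ p) (c : ℝ) (hc : 0 ≤ c) (x : Fin n → X) :
    weakSummingNorm p (fun i => (c : ℂ) • x i) ≤ c * weakSummingNorm p x := by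
  refine weakSummingNorm_le hp fun α hα => ?_
  have h : ∑ i, α i • (c : ℂ) • x i = (c : ℂ) • ∑ i, α i • x i := by
    rw [Finset.smul_sum]
    exact Finset.sum_congr rfl fun i _ => smul_comm _ _ _
  rw [h, norm_smul, Complex.norm_real, Real.norm_of_nonneg hc]
  exact mul_le_mul_of_nonneg_left (norm_sum_smul_le_weakSummingNorm hp x hα) hc

/-- The weak `p`-summing norm does not increase on passing to the second dual. -/
lemma weakSummingNorm_inclusionInDoubleDual_le (hp : 1 ≤ p) (x : Fin n → X) :
    weakSummingNorm p (fun i => NormedSpace.inclusionInDoubleDual ℂ X (x i)) ≤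
      weakSummingNorm p x := by
  refine weakSummingNorm_le hp fun α hα => ?_
  refine le_trans ?_ (norm_sum_smul_le_weakSummingNorm hp x hα)
  simp only [← map_smul, ← map_sum]
  exact NormedSpace.double_dual_bound ℂ X _

/-- The multi-norm of a tuple of functionals on `X` bounds its pairing with a tuple in `X`,
viewed as a tuple of functionals on the dual of `X`. -/
lemma rpow_sum_apply_le_weakMultiNorm (hp : 1 ≤ p) (φ : Fin n → StrongDual ℂ X)
    (f : Fin n → X) {K : ℝ} (hK : 0 < K) (h : weakSummingNorm p f ≤ K) :
    (∑ i, ‖φ i (f i)‖ ^ p) ^ (1 / p) ≤ weakMultiNorm p p φ * K := by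
  let l : Fin n → StrongDual ℂ (StrongDual ℂ X) := fun i =>
    ((K⁻¹ : ℝ) : ℂ) • NormedSpace.inclusionInDoubleDual ℂ X (f i)
  have hl : weakSummingNorm p l ≤ 1 := by
    refine (weakSummingNorm_smul_le hp K⁻¹ (inv_nonneg.2 hK.le) _).trans ?_
    rw [inv_mul_le_iff₀ hK, mul_one]
    exact (weakSummingNorm_inclusionInDoubleDual_le hp f).trans h
  have h1 := le_ciSup (bddAbove_weakMultiNorm hp hp φ) ⟨l, hl⟩
  have h2 (i : Fin n) : ‖l i (φ i)‖ = K⁻¹ * ‖φ i (f i)‖ := by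
    simp only [l, smul_apply, NormedSpace.dual_def, norm_smul, Complex.norm_real,
      Real.norm_of_nonneg (inv_nonneg.2 hK.le)]
  simp only [h2] at h1
  rw [rpow_sum_mul hp (inv_nonneg.2 hK.le) fun i => norm_nonneg _, inv_mul_le_iff₀ hK] at h1
  rw [mul_comm]
  exact h1

/-- The dual of a finite `ℓ^∞`-sum is, up to a factor `2`, the `ℓ^1`-sum of the duals. -/
lemma sum_norm_comp_single_le {κ : Type*} [Fintype κ] [DecidableEq κ]
    (Ψ : StrongDual ℂ (κ → X)) :
    ∑ k, ‖Ψ ∘L ContinuousLinearMap.single ℂ (fun _ : κ => X) k‖ ≤ 2 * ‖Ψ‖ := by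
  set l : κ → StrongDual ℂ X := fun k => Ψ ∘L ContinuousLinearMap.single ℂ (fun _ : κ => X) k
  have h1 (k : κ) : ∃ x : X, ‖x‖ ≤ 1 ∧ ‖l k‖ ≤ 2 * ‖l k x‖ := by
    rcases eq_or_ne (l k) 0 with h | h
    · exact ⟨0, by simp, by simp [h]⟩
    · obtain ⟨x, hx, hlx⟩ := (l k).exists_lt_apply_of_lt_opNorm (r := ‖l k‖ / 2)
        (half_lt_self (norm_pos_iff.2 h))
      exact ⟨x, hx.le, by linarith⟩
  choose x hx hlx using h1
  have h2 (k : κ) : ∃ c : ℂ, ‖c‖ ≤ 1 ∧ (‖l k (x k)‖ : ℂ) = c * l k (x k) := by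
    obtain ⟨c, hc, h⟩ := RCLike.exists_norm_eq_mul_self (l k (x k))
    exact ⟨c, hc.le, h⟩
  choose c hc hcx using h2
  have h3 : ((∑ k, ‖l k (x k)‖ : ℝ) : ℂ) = Ψ fun k => c k • x k := by
    rw [← LinearMap.sum_single_apply (fun _ : κ => X) (fun k => c k • x k), map_sum]
    push_cast
    refine Finset.sum_congr rfl fun k _ => ?_
    rw [hcx, ← smul_eq_mul, ← map_smul]
    rfl
  have h4 : ∑ k, ‖l k (x k)‖ ≤ ‖Ψ‖ := by
    have h5 : ‖((∑ k, ‖l k (x k)‖ : ℝ) : ℂ)‖ ≤ ‖Ψ‖ * 1 := by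
      rw [h3]
      refine Ψ.le_opNorm_of_le ((pi_norm_le_iff_of_nonneg zero_le_one).2 fun k => ?_)
      rw [norm_smul]
      exact mul_le_one₀ (hc k) (norm_nonneg _) (hx k)
    rw [Complex.norm_real, mul_one] at h5
    exact (le_abs_self _).trans h5
  calc ∑ k, ‖l k‖ ≤ ∑ k, 2 * ‖l k (x k)‖ := Finset.sum_le_sum fun k _ => hlx k
    _ = 2 * ∑ k, ‖l k (x k)‖ := by rw [Finset.mul_sum]
    _ ≤ 2 * ‖Ψ‖ := by linarith

/-- A form of local reflexivity. On `X ^ n` the weak `p`-summing norm is equivalent to a maximum of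
finitely many norms `f ↦ ‖∑ i, α i • f i‖`. So a functional bounded by it is a finite sum of
functionals `f ↦ l (∑ i, α i • f i)`, and its bound passes to the second dual of `X`. -/
theorem weakMultiNorm_dual_le (hp : 1 ≤ p) (φ : Fin n → StrongDual ℂ X) {C : ℝ} (hC : 0 ≤ C)
    (h : ∀ f : Fin n → X, (∑ i, ‖φ i (f i)‖ ^ p) ^ (1 / p) ≤ C * weakSummingNorm p f) :
    weakMultiNorm p p φ ≤ 4 * C := by
  classical
  have : Nonempty {l : Fin n → StrongDual ℂ (StrongDual ℂ X) // weakSummingNorm p l ≤ 1} :=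
    ⟨⟨0, weakSummingNorm_le hp fun α _ => by
      simp only [Pi.zero_apply, smul_zero, Finset.sum_const_zero]
      exact (norm_zero (E := StrongDual ℂ (StrongDual ℂ X))).trans_le zero_le_one⟩⟩
  refine ciSup_le fun ⟨L, hL⟩ => ?_
  obtain ⟨a, ha, haL⟩ := exists_mem_lpDualBall hp fun i => L i (φ i)
  obtain ⟨A, hA, hnet⟩ := exists_half_net_lpDualBall (ι := Fin n) hp
  let J : (Fin n → X) →ₗ[ℂ] (A → X) :=
    LinearMap.pi fun k => ∑ i, (k.1 i) • LinearMap.proj i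
  have hJ (f : Fin n → X) (k : A) : J f k = ∑ i, k.1 i • f i := by simp [J]
  -- `J` is bounded below for the weak summing norm, because `A` is a `1/2`-net
  have hbelow (f : Fin n → X) : weakSummingNorm p f ≤ 2 * ‖J f‖ := by
    have h1 : weakSummingNorm p f ≤ ‖J f‖ + 1 / 2 * weakSummingNorm p f := by
      refine weakSummingNorm_le hp fun β hβ => ?_
      obtain ⟨α, hα, hβα⟩ := hnet β hβ
      have h2 : ∑ i, β i • f i = J f ⟨α, hα⟩ + ∑ i, (β i - α i) • f i := by
        rw [hJ, ← Finset.sum_add_distrib]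
        exact Finset.sum_congr rfl fun i _ => by rw [sub_smul, add_sub_cancel]
      rw [h2]
      refine norm_add_le_of_le (norm_le_pi_norm (J f) _) ?_
      obtain ⟨l, hl, hx⟩ := exists_dual_vector'' ℂ (∑ i, (β i - α i) • f i)
      rw [← RCLike.norm_coe_norm (𝕜 := ℂ) (z := ∑ i, (β i - α i) • f i), ← hx, map_sum]
      simp only [map_smul, smul_eq_mul]
      exact (hβα _).trans (mul_le_mul_of_nonneg_left (rpow_sum_le_weakSummingNorm hp f hl)
        (by norm_num))
    linarith
  have hinj : Function.Injective J := by
    rw [← LinearMap.ker_eq_bot, LinearMap.ker_eq_bot']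
    intro f hf
    funext i
    have := (norm_le_weakSummingNorm hp f i).trans (hbelow f)
    rw [hf, norm_zero, mul_zero] at this
    exact norm_le_zero_iff.1 this
  let ψ : (Fin n → X) →ₗ[ℂ] ℂ := ∑ i, a i • ((φ i).toLinearMap ∘ₗ LinearMap.proj i)
  have hψ (f : Fin n → X) : ψ f = ∑ i, a i * φ i (f i) := by simp [ψ]
  have hψb (f : Fin n → X) : ‖ψ f‖ ≤ 2 * C * ‖J f‖ := by
    rw [hψ]
    calc _ ≤ _ := ha fun i => φ i (f i)
      _ ≤ C * weakSummingNorm p f := h f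
      _ ≤ C * (2 * ‖J f‖) := mul_le_mul_of_nonneg_left (hbelow f) hC
      _ = 2 * C * ‖J f‖ := by ring
  -- so `f ↦ ∑ i, a i * φ i (f i)` factors through `J`, and extends from the range of `J` with the
  -- same norm; the components of the extension are the functionals `l k`
  let e := LinearEquiv.ofInjective J hinj
  have he (y : LinearMap.range J) : J (e.symm y) = y := by
    have := congrArg Subtype.val (e.apply_symm_apply y)
    rwa [LinearEquiv.ofInjective_apply] at this
  let ψ' : StrongDual ℂ (LinearMap.range J) :=
    LinearMap.mkContinuous (ψ ∘ₗ e.symm.toLinearMap) (2 * C) fun y => by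
      have := hψb (e.symm y)
      rw [he] at this
      exact this
  obtain ⟨Ψ, hΨ, hΨn⟩ := exists_extension_norm_eq (LinearMap.range J) ψ'
  have hΨ2 : ‖Ψ‖ ≤ 2 * C := hΨn ▸ LinearMap.mkContinuous_norm_le _ (by positivity) _
  have hΨJ (f : Fin n → X) : Ψ (J f) = ψ f := by
    have h1 := hΨ (e f)
    have h2 : ψ' (e f) = ψ f := by
      change ψ (e.symm (e f)) = ψ f
      rw [LinearEquiv.symm_apply_apply]
    rw [h2] at h1
    exact h1
  let l : A → StrongDual ℂ X := fun k => Ψ ∘L ContinuousLinearMap.single ℂ (fun _ : A => X) k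
  have hl (y : A → X) : Ψ y = ∑ k, l k (y k) := by
    conv_lhs => rw [← LinearMap.sum_single_apply (fun _ : A => X) y, map_sum]
    rfl
  have haφ (i : Fin n) : a i • φ i = ∑ k : A, k.1 i • l k := by
    ext x
    have h1 := hΨJ (Pi.single i x)
    rw [hψ, hl] at h1
    simp only [hJ] at h1
    rw [Finset.sum_eq_single i (fun j _ hj => by simp [Pi.single_eq_of_ne hj]) (by simp)] at h1
    simp only [Pi.single_eq_same] at h1
    rw [smul_apply, smul_eq_mul, ← h1, sum_apply]
    refine Finset.sum_congr rfl fun k _ => ?_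
    rw [Finset.sum_eq_single i (fun j _ hj => by simp [Pi.single_eq_of_ne hj]) (by simp)]
    simp
  have hmain : ∑ i, a i * L i (φ i) = ∑ k : A, (∑ i, k.1 i • L i) (l k) := by
    calc ∑ i, a i * L i (φ i) = ∑ i, L i (a i • φ i) := by simp
      _ = ∑ i, ∑ k : A, k.1 i * L i (l k) := by simp only [haφ, map_sum, map_smul, smul_eq_mul]
      _ = ∑ k : A, ∑ i, k.1 i * L i (l k) := Finset.sum_comm
      _ = _ := by simp
  calc (∑ i, ‖L i (φ i)‖ ^ p) ^ (1 / p) ≤ ‖∑ i, a i * L i (φ i)‖ := by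
        rw [haL, Complex.norm_real]; exact le_abs_self _
    _ ≤ ∑ k : A, ‖l k‖ := by
        rw [hmain]
        refine norm_sum_le_of_le _ fun k _ => ?_
        have := (∑ i, k.1 i • L i).le_of_opNorm_le
          ((norm_sum_smul_le_weakSummingNorm hp L (hA k.1 k.2)).trans hL) (l k)
        rwa [one_mul] at this
    _ ≤ 2 * ‖Ψ‖ := sum_norm_comp_single_le Ψ
    _ ≤ 4 * C := by linarith

end WeakSumming

/-! ### Operators on `ℓ¹(G)` and point masses -/

section PointMasses

variable {G : Type u}

/-- The point mass at `t`, as an element of `ℓ^p(G)`. -/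
noncomputable def lpDelta (p : ℝ≥0∞) (t : G) : ℓ^p(G, ℂ) := by
  classical exact lp.single p t (1 : ℂ)

@[simp] lemma lpDelta_apply_self (p : ℝ≥0∞) (t : G) : lpDelta p t t = 1 := by
  simp [lpDelta]

lemma lpDelta_apply_of_ne (p : ℝ≥0∞) {t s : G} (h : s ≠ t) : lpDelta p t s = 0 := by
  simp [lpDelta, h]

lemma tsumCLM_lpDelta (t : G) : lp.tsumCLM ℂ G ℂ (lpDelta 1 t) = 1 := by
  have h : ∑' s, (lpDelta 1 t : ℓ¹(G, ℂ)) s = (lpDelta 1 t : ℓ¹(G, ℂ)) t :=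
    tsum_eq_single t fun s hs => lpDelta_apply_of_ne 1 hs
  exact h.trans (lpDelta_apply_self 1 t)

lemma norm_lpDelta (p : ℝ≥0∞) [Fact (1 ≤ p)] (t : G) : ‖lpDelta p t‖ = 1 := by
  classical
  rw [lpDelta, lp.norm_single (zero_lt_one.trans_le Fact.out), norm_one]

variable {X : Type*} [NormedAddCommGroup X] [NormedSpace ℂ X]

lemma ellOne_ext {T T' : ℓ¹(G, ℂ) →L[ℂ] X} (h : ∀ t, T (lpDelta 1 t) = T' (lpDelta 1 t)) :
    T = T' := by
  classical
  refine lp.ext_continuousLinearMap ENNReal.one_ne_top fun t => ?_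
  ext
  simpa [lpDelta] using h t

section Lift

variable [CompleteSpace X]

/-- The operator `ℓ¹(G) → X` with values `u t` at the point masses, for a bounded family `u`. -/
noncomputable def ellOneLift (u : G → X) {K : ℝ} (hK : 0 ≤ K) (hu : ∀ t, ‖u t‖ ≤ K) :
    ℓ¹(G, ℂ) →L[ℂ] X :=
  lp.tsumCLM ℂ G X ∘L lp.mapCLM 1 (fun t => ContinuousLinearMap.toSpanSingleton ℂ (u t)) hK
    fun t => by simpa using hu t

@[simp] lemma ellOneLift_lpDelta (u : G → X) {K : ℝ} (hK : 0 ≤ K) (hu : ∀ t, ‖u t‖ ≤ K) (t : G) :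
    ellOneLift u hK hu (lpDelta 1 t) = u t := by
  change ∑' s, (lpDelta 1 t : ℓ¹(G, ℂ)) s • u s = u t
  rw [tsum_eq_single t fun s hs => by rw [lpDelta_apply_of_ne 1 hs, zero_smul],
    lpDelta_apply_self, one_smul]

lemma norm_ellOneLift_le (u : G → X) {K : ℝ} (hK : 0 ≤ K) (hu : ∀ t, ‖u t‖ ≤ K) :
    ‖ellOneLift u hK hu‖ ≤ K := by
  refine (ContinuousLinearMap.opNorm_comp_le _ _).trans ?_
  calc _ ≤ 1 * K := mul_le_mul lp.norm_tsumCLM_le (lp.norm_mapCLM_le _ _ _ _) (norm_nonneg _)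
        zero_le_one
    _ = K := one_mul K

end Lift

lemma norm_ellOne_apply_lpDelta_le (T : ℓ¹(G, ℂ) →L[ℂ] X) (t : G) : ‖T (lpDelta 1 t)‖ ≤ ‖T‖ := by
  simpa [norm_lpDelta] using T.le_opNorm (lpDelta 1 t)

lemma norm_ellOne_le [CompleteSpace X] (T : ℓ¹(G, ℂ) →L[ℂ] X) {K : ℝ} (hK : 0 ≤ K)
    (h : ∀ t, ‖T (lpDelta 1 t)‖ ≤ K) : ‖T‖ ≤ K := by
  have hT : T = ellOneLift (fun t => T (lpDelta 1 t)) hK h := ellOne_ext fun t => by simp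
  rw [hT]
  exact norm_ellOneLift_le _ _ _

/-- The weak `p`-summing norm of a tuple of bounded functions on `G` is at most the supremum over
`t` of the `ℓ^p`-norm of the tuple of values at `t`. -/
lemma weakSummingNorm_ellOneDual_le {p : ℝ} (hp : 1 ≤ p) {n : ℕ}
    (f : Fin n → StrongDual ℂ ℓ¹(G, ℂ)) {K : ℝ} (hK : 0 ≤ K)
    (h : ∀ t, (∑ i, ‖f i (lpDelta 1 t)‖ ^ p) ^ (1 / p) ≤ K) : weakSummingNorm p f ≤ K := by
  refine weakSummingNorm_le hp fun α hα => ?_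
  refine norm_ellOne_le (∑ i, α i • f i) hK fun t => ?_
  have e : (∑ i, α i • f i) (lpDelta 1 t) = ∑ i, α i * f i (lpDelta 1 t) := by
    rw [sum_apply]
    rfl
  rw [e]
  exact (hα fun i => f i (lpDelta 1 t)).trans (h t)

lemma rpow_sum_apply_lpDelta_le {p : ℝ} (hp : 1 ≤ p) {n : ℕ}
    (f : Fin n → StrongDual ℂ ℓ¹(G, ℂ)) (t : G) :
    (∑ i, ‖f i (lpDelta 1 t)‖ ^ p) ^ (1 / p) ≤ weakSummingNorm p f := by
  have h : ‖NormedSpace.inclusionInDoubleDual ℂ ℓ¹(G, ℂ) (lpDelta 1 t)‖ ≤ 1 :=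
    (NormedSpace.double_dual_bound ℂ ℓ¹(G, ℂ) _).trans (norm_lpDelta 1 t).le
  simpa only [NormedSpace.dual_def] using rpow_sum_le_weakSummingNorm hp f h

end PointMasses

/-! ### Translation and convolution at point masses -/

section Translations

variable {G : Type u} [Group G] {p : ℝ≥0∞} [Fact (1 ≤ p)]

@[simp] lemma lpTranslate_lpDelta (s t : G) :
    lpTranslate p s (lpDelta p t) = lpDelta p (s * t) := by
  refine lp.ext (funext fun r => ?_)
  rw [lpTranslate_apply]
  by_cases h : r = s * t
  · subst h
    simp
  · rw [lpDelta_apply_of_ne p h, lpDelta_apply_of_ne p]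
    rintro rfl
    simp at h

@[simp] lemma lpConv_lpDelta (t : G) (g : ℓ^p(G, ℂ)) :
    lpConv (lpDelta 1 t) g = lpTranslate p t g := by
  rw [lpConv_eq_tsum,
    tsum_eq_single t fun s hs => by rw [lpDelta_apply_of_ne 1 hs, zero_smul],
    lpDelta_apply_self, one_smul]

@[simp] lemma ellModule_act_lpDelta (t : G) (g : ℓ^p(G, ℂ)) :
    (ellModule G p).act (lpDelta 1 t) g = lpTranslate p t g := lpConv_lpDelta t g

lemma lpDelta_mul_lpDelta (s t : G) :
    (lpDelta 1 s * lpDelta 1 t : ℓ¹(G, ℂ)) = lpDelta 1 (s * t) :=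
  (lpConv_lpDelta s (lpDelta 1 t)).trans (lpTranslate_lpDelta s t)

@[simp] lemma lpTranslate_one (g : ℓ^p(G, ℂ)) : lpTranslate p 1 g = g := by
  refine lp.ext (funext fun r => ?_)
  simp

lemma isMorphism_of_lpDelta {E F : Type*} [NormedAddCommGroup E] [NormedSpace ℂ E]
    [NormedAddCommGroup F] [NormedSpace ℂ F] {ME : BanachLeftModule ℓ¹(G, ℂ) E}
    {MF : BanachLeftModule ℓ¹(G, ℂ) F} {T : E →L[ℂ] F}
    (h : ∀ t x, T (ME.act (lpDelta 1 t) x) = MF.act (lpDelta 1 t) (T x)) :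
    ME.IsMorphism MF T := by
  intro a x
  have e : T ∘L ME.act.flip x = MF.act.flip (T x) := ellOne_ext fun t => h t x
  exact congrArg (fun S : ℓ¹(G, ℂ) →L[ℂ] F => S a) e

end Translations

/-! ### Extension of morphisms along the orbit of a mean -/

section AmenableToInjective

variable {G : Type u} [Group G]

variable {p : ℝ≥0∞} [Fact (1 ≤ p)]

/-- If the orbit of `L` is multi-bounded, then a bounded family `U t ∈ ℓ^p(G)` can be evaluated
along the orbit: `r ↦ ⟨U(·)(r), r · L⟩` is in `ℓ^p(G)`, and depends boundedly on `U`. -/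
lemma exists_orbit_evaluation (hp' : p < ∞) {L : EllOneBidual G}
    (hL : IsWeakMultiBounded p.toReal p.toReal (Set.range fun s : G => bidualTranslate s L)) :
    ∃ Φ : (ℓ¹(G, ℂ) →L[ℂ] ℓ^p(G, ℂ)) →L[ℂ] ℓ^p(G, ℂ),
      ∀ U r, Φ U r = bidualTranslate r L (lp.evalCLM ℂ (fun _ : G => ℂ) p r ∘L U) := by
  have hp1 : 1 ≤ p.toReal := by
    simpa using ENNReal.toReal_mono hp'.ne (Fact.out : 1 ≤ p)
  have hp0 : 0 < p.toReal := by linarith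
  obtain ⟨C, hC⟩ := hL
  have hC' : ∀ (n : ℕ) (x : Fin n → EllOneBidual G),
      (∀ i, x i ∈ Set.range fun s : G => bidualTranslate s L) →
      weakMultiNorm p.toReal p.toReal x ≤ max C 0 := fun n x hx =>
    (hC n x hx).trans (le_max_left _ _)
  have hsum (U : ℓ¹(G, ℂ) →L[ℂ] ℓ^p(G, ℂ)) (S : Finset G) :
      ∑ r ∈ S, ‖bidualTranslate r L (lp.evalCLM ℂ (fun _ : G => ℂ) p r ∘L U)‖ ^ p.toReal ≤
        (max C 0 * ‖U‖) ^ p.toReal := by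
    rcases eq_or_ne U 0 with rfl | hU
    · simp [Real.zero_rpow hp0.ne']
    have hU0 : 0 < ‖U‖ := norm_pos_iff.2 hU
    let s : Fin S.card → G := fun i => S.equivFin.symm i
    have hs (F : G → ℝ) : ∑ i, F (s i) = ∑ r ∈ S, F r := by
      rw [← Finset.sum_coe_sort S F]
      exact S.equivFin.symm.sum_comp fun r : S => F r
    have h1 := rpow_sum_apply_le_weakMultiNorm hp1 (fun i => bidualTranslate (s i) L)
      (fun i => lp.evalCLM ℂ (fun _ : G => ℂ) p (s i) ∘L U) hU0 <|
      weakSummingNorm_ellOneDual_le hp1 _ hU0.le fun t => by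
        rw [hs fun r => ‖(lp.evalCLM ℂ (fun _ : G => ℂ) p r ∘L U) (lpDelta 1 t)‖ ^ p.toReal,
          one_div, Real.rpow_inv_le_iff_of_pos (Finset.sum_nonneg fun r _ =>
            Real.rpow_nonneg (norm_nonneg _) _) hU0.le hp0]
        refine (lp.sum_rpow_le_norm_rpow hp0 (U (lpDelta 1 t)) S).trans ?_
        exact Real.rpow_le_rpow (norm_nonneg _) (norm_ellOne_apply_lpDelta_le U t) hp0.le
    rw [hs fun r => ‖bidualTranslate r L (lp.evalCLM ℂ (fun _ : G => ℂ) p r ∘L U)‖ ^ p.toReal]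
      at h1
    have h2 := h1.trans (mul_le_mul_of_nonneg_right
      (hC' _ (fun i => bidualTranslate (s i) L) fun i => ⟨s i, rfl⟩) hU0.le)
    rwa [one_div, Real.rpow_inv_le_iff_of_pos (Finset.sum_nonneg fun r _ =>
      Real.rpow_nonneg (norm_nonneg _) _) (by positivity) hp0] at h2
  refine ⟨LinearMap.mkContinuous
    { toFun := fun U => ⟨fun r => bidualTranslate r L (lp.evalCLM ℂ (fun _ : G => ℂ) p r ∘L U),
        memℓp_gen' (hsum U)⟩
      map_add' := fun U U' => lp.ext (funext fun r => ?_)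
      map_smul' := fun c U => lp.ext (funext fun r => ?_) } (max C 0) fun U => ?_, fun U r => rfl⟩
  · change bidualTranslate r L _ = bidualTranslate r L _ + bidualTranslate r L _
    rw [ContinuousLinearMap.comp_add, map_add]
  · change bidualTranslate r L _ = c • bidualTranslate r L _
    rw [ContinuousLinearMap.comp_smul, map_smul]
  · exact lp.norm_le_of_forall_sum_le hp0 (by positivity) (hsum U)

/-- The extension of `S` along `T` is `y ↦ (r ↦ ⟨(t · S (V (t⁻¹ · y)))(r), r · L⟩)`. -/
theorem isInjective_of_isPQAmenable (hp' : p < ∞) (h : IsPQAmenable G p.toReal p.toReal) :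
    (ellModule G p).IsInjective := by
  obtain ⟨L, ⟨hL1, -⟩, hL⟩ := h
  obtain ⟨Φ, hΦ⟩ := exists_orbit_evaluation hp' hL
  intro E F _ _ _ _ _ _ ME MF T S hT ⟨V, hV⟩ hS
  let w : G → F →L[ℂ] ℓ^p(G, ℂ) := fun t =>
    lpTranslate p t ∘L S ∘L V ∘L MF.act (lpDelta 1 t⁻¹)
  have hw (t : G) : ‖w t‖ ≤ ‖S‖ * ‖V‖ * ‖MF.act‖ := by
    refine ContinuousLinearMap.opNorm_le_bound _ (by positivity) fun y => ?_
    calc ‖w t y‖ ≤ ‖S (V (MF.act (lpDelta 1 t⁻¹) y))‖ := norm_lpTranslate_le _ _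
      _ ≤ ‖S‖ * (‖V‖ * (‖MF.act‖ * ‖y‖)) := by
        refine S.le_opNorm_of_le (V.le_opNorm_of_le ?_)
        exact (MF.act (lpDelta 1 t⁻¹)).le_of_opNorm_le (norm_ellOne_apply_lpDelta_le _ _) y
      _ = ‖S‖ * ‖V‖ * ‖MF.act‖ * ‖y‖ := by ring
  let B : ℓ¹(G, ℂ) →L[ℂ] F →L[ℂ] ℓ^p(G, ℂ) := ellOneLift w (by positivity) hw
  have hB (y : F) (t : G) : B.flip y (lpDelta 1 t) = w t y := by
    rw [ContinuousLinearMap.flip_apply, ellOneLift_lpDelta]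
  refine ⟨Φ ∘L B.flip, isMorphism_of_lpDelta fun s y => ?_, ?_⟩
  · -- equivariance of `y ↦ (w t y)` and of evaluation along the orbit
    refine lp.ext (funext fun r => ?_)
    rw [ellModule_act_lpDelta, lpTranslate_apply, ContinuousLinearMap.comp_apply,
      ContinuousLinearMap.comp_apply, hΦ, hΦ, bidualTranslate_apply, bidualTranslate_apply]
    congr 1
    refine ellOne_ext fun t => ?_
    change (B.flip (MF.act (lpDelta 1 s) y) (lpTranslate 1 r (lpDelta 1 t))) r =
      (B.flip y (lpTranslate 1 (s⁻¹ * r) (lpDelta 1 t))) (s⁻¹ * r)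
    rw [lpTranslate_lpDelta, lpTranslate_lpDelta, hB, hB]
    change S (V (MF.act _ (MF.act _ y))) ((r * t)⁻¹ * r) =
      S (V (MF.act _ y)) ((s⁻¹ * r * t)⁻¹ * (s⁻¹ * r))
    rw [← MF.act_mul, lpDelta_mul_lpDelta]
    group
  · refine ContinuousLinearMap.ext fun x => lp.ext (funext fun r => ?_)
    rw [ContinuousLinearMap.comp_apply, ContinuousLinearMap.comp_apply, hΦ, bidualTranslate_apply]
    have h1 : (lp.evalCLM ℂ (fun _ : G => ℂ) p r ∘L B.flip (T x)) ∘L lpTranslate 1 r =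
        S x r • lp.tsumCLM ℂ G ℂ := by
      refine ellOne_ext fun t => ?_
      have h2 : V (T (ME.act (lpDelta 1 (r * t)⁻¹) x)) = ME.act (lpDelta 1 (r * t)⁻¹) x :=
        DFunLike.congr_fun hV _
      change (B.flip (T x) (lpTranslate 1 r (lpDelta 1 t))) r =
        S x r * lp.tsumCLM ℂ G ℂ (lpDelta 1 t)
      rw [lpTranslate_lpDelta, hB, tsumCLM_lpDelta, mul_one]
      change S (V (MF.act _ (T x))) ((r * t)⁻¹ * r) = _
      rw [← hT, h2, hS, ellModule_act_lpDelta, lpTranslate_apply]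
      group
    rw [h1, map_smul, hL1, smul_eq_mul, mul_one]

end AmenableToInjective

/-! ### The diagonal of an operator into `ℓ^p(G)` -/

section Diagonal

lemma norm_half_smul_add_le {V W : Type*} [NormedAddCommGroup V] [NormedSpace ℂ V]
    [NormedAddCommGroup W] [NormedSpace ℂ W] {A B : V →L[ℂ] W} {K : ℝ} (hA : ‖A‖ ≤ K)
    (hB : ‖B‖ ≤ K) : ‖(1 / 2 : ℂ) • (A + B)‖ ≤ K := by
  have h2 : ‖(1 / 2 : ℂ)‖ = 1 / 2 := by norm_num
  have h := norm_add_le_of_le hA hB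
  rw [norm_smul, h2]
  linarith

variable {G : Type u} {p : ℝ≥0∞} [Fact (1 ≤ p)]

/-- The coordinate projection of `ℓ^p(G)` onto the span of the point mass at `s`. -/
noncomputable def lpCoordProj (p : ℝ≥0∞) [Fact (1 ≤ p)] (s : G) : ℓ^p(G, ℂ) →L[ℂ] ℓ^p(G, ℂ) :=
  (lp.evalCLM ℂ (fun _ : G => ℂ) p s).smulRight (lpDelta p s)

/-- The change of sign of the coordinate at `s`. -/
noncomputable def lpSignFlip (p : ℝ≥0∞) [Fact (1 ≤ p)] (s : G) : ℓ^p(G, ℂ) →L[ℂ] ℓ^p(G, ℂ) :=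
  ContinuousLinearMap.id ℂ _ - (2 : ℂ) • lpCoordProj p s

lemma lpSignFlip_apply_self (s : G) (x : ℓ^p(G, ℂ)) : lpSignFlip p s x s = -x s := by
  change x s - 2 * (x s * lpDelta p s s) = -x s
  rw [lpDelta_apply_self]
  ring

lemma lpSignFlip_apply_of_ne {s r : G} (h : r ≠ s) (x : ℓ^p(G, ℂ)) :
    lpSignFlip p s x r = x r := by
  change x r - 2 * (x s * lpDelta p s r) = x r
  rw [lpDelta_apply_of_ne p h]
  ring

lemma norm_lpSignFlip_le (s : G) : ‖lpSignFlip p s‖ ≤ 1 := by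
  refine ContinuousLinearMap.opNorm_le_bound _ zero_le_one fun x => ?_
  rw [one_mul]
  refine lp.norm_mono (zero_lt_one.trans_le Fact.out).ne' fun r => ?_
  by_cases h : r = s
  · rw [h, lpSignFlip_apply_self, norm_neg]
  · rw [lpSignFlip_apply_of_ne h]

lemma lpSignFlip_comp_lpCoordProj_self (s : G) :
    lpSignFlip p s ∘L lpCoordProj p s = -lpCoordProj p s := by
  refine ContinuousLinearMap.ext fun x => ?_
  change x s • lpDelta p s - (2 : ℂ) • (x s * lpDelta p s s) • lpDelta p s = -(x s • lpDelta p s)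
  rw [lpDelta_apply_self]
  module

lemma lpSignFlip_comp_lpCoordProj_of_ne {s r : G} (h : r ≠ s) :
    lpSignFlip p s ∘L lpCoordProj p r = lpCoordProj p r := by
  refine ContinuousLinearMap.ext fun x => ?_
  change x r • lpDelta p r - (2 : ℂ) • (x r * lpDelta p r s) • lpDelta p s = x r • lpDelta p r
  rw [lpDelta_apply_of_ne p h.symm]
  module

lemma lpCoordProj_comp_lpSignFlip_of_ne {s r : G} (h : r ≠ s) :
    lpCoordProj p r ∘L lpSignFlip p s = lpCoordProj p r := by
  refine ContinuousLinearMap.ext fun x => ?_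
  change lpSignFlip p s x r • lpDelta p r = x r • lpDelta p r
  rw [lpSignFlip_apply_of_ne h]

variable {Y : Type*} [NormedAddCommGroup Y] [NormedSpace ℂ Y]

/-- Averaging an operator with its conjugate by a sign change at `s` makes it diagonal at the
coordinate `s`, leaves its diagonal part unchanged and does not increase its norm. -/
lemma exists_diagonal_on (Q : (Y →L[ℂ] ℓ^p(G, ℂ)) →L[ℂ] ℓ^p(G, ℂ)) (S : Finset G) :
    ∃ Q' : (Y →L[ℂ] ℓ^p(G, ℂ)) →L[ℂ] ℓ^p(G, ℂ), ‖Q'‖ ≤ ‖Q‖ ∧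
      (∀ r U, Q' (lpCoordProj p r ∘L U) r = Q (lpCoordProj p r ∘L U) r) ∧
      ∀ r ∈ S, ∀ U, Q' U r = Q (lpCoordProj p r ∘L U) r := by
  classical
  induction S using Finset.induction_on with
  | empty => exact ⟨Q, le_rfl, fun _ _ => rfl, by simp⟩
  | insert s S hs ih =>
    obtain ⟨Q', hn, hdiag, hS⟩ := ih
    let D := lpSignFlip p s
    let c : (Y →L[ℂ] ℓ^p(G, ℂ)) →L[ℂ] (Y →L[ℂ] ℓ^p(G, ℂ)) := ContinuousLinearMap.compL ℂ Y _ _ D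
    let R := (1 / 2 : ℂ) • (Q' + D ∘L Q' ∘L c)
    have hR (U) (r : G) : R U r = 1 / 2 * (Q' U r + D (Q' (D ∘L U)) r) := rfl
    have hc : ‖c‖ ≤ 1 := by
      refine ContinuousLinearMap.opNorm_le_bound _ zero_le_one fun U => ?_
      exact (ContinuousLinearMap.opNorm_comp_le _ _).trans
        (mul_le_mul_of_nonneg_right (norm_lpSignFlip_le s) (norm_nonneg _))
    have hDQ : ‖D ∘L Q' ∘L c‖ ≤ ‖Q'‖ := by
      refine (ContinuousLinearMap.opNorm_comp_le _ _).trans ?_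
      refine (mul_le_of_le_one_left (norm_nonneg _) (norm_lpSignFlip_le s)).trans ?_
      exact (ContinuousLinearMap.opNorm_comp_le _ _).trans
        (mul_le_of_le_one_right (norm_nonneg _) hc)
    refine ⟨R, ?_, fun r U => ?_, fun r hr U => ?_⟩
    · exact norm_half_smul_add_le hn (hDQ.trans hn)
    · rw [← hdiag, hR, ← ContinuousLinearMap.comp_assoc]
      by_cases h : r = s
      · subst h
        rw [lpSignFlip_comp_lpCoordProj_self, lpSignFlip_apply_self,
          ContinuousLinearMap.neg_comp, map_neg, lp.coeFn_neg, Pi.neg_apply]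
        ring
      · rw [lpSignFlip_comp_lpCoordProj_of_ne h, lpSignFlip_apply_of_ne h]
        ring
    · rw [hR]
      by_cases h : r = s
      · subst h
        have h1 : D ∘L U = U - (2 : ℂ) • (lpCoordProj p r ∘L U) := rfl
        rw [lpSignFlip_apply_self, h1, map_sub, map_smul, lp.coeFn_sub, Pi.sub_apply,
          lp.coeFn_smul, Pi.smul_apply, hdiag, smul_eq_mul]
        ring
      · rw [lpSignFlip_apply_of_ne h, hS r (Finset.mem_of_mem_insert_of_ne hr h),
          hS r (Finset.mem_of_mem_insert_of_ne hr h), ← ContinuousLinearMap.comp_assoc,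
          lpCoordProj_comp_lpSignFlip_of_ne h]
        ring

/-- The diagonal part of a bounded operator into `ℓ^p(G)` is bounded by the norm of the operator. -/
lemma sum_norm_diagonal_le (hp0 : 0 < p.toReal) (Q : (Y →L[ℂ] ℓ^p(G, ℂ)) →L[ℂ] ℓ^p(G, ℂ))
    (S : Finset G) (U : Y →L[ℂ] ℓ^p(G, ℂ)) :
    ∑ r ∈ S, ‖Q (lpCoordProj p r ∘L U) r‖ ^ p.toReal ≤ (‖Q‖ * ‖U‖) ^ p.toReal := by
  obtain ⟨Q', hn, -, hS⟩ := exists_diagonal_on Q S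
  calc ∑ r ∈ S, ‖Q (lpCoordProj p r ∘L U) r‖ ^ p.toReal = ∑ r ∈ S, ‖Q' U r‖ ^ p.toReal :=
        Finset.sum_congr rfl fun r hr => by rw [hS r hr U]
    _ ≤ ‖Q' U‖ ^ p.toReal := lp.sum_rpow_le_norm_rpow hp0 _ S
    _ ≤ (‖Q‖ * ‖U‖) ^ p.toReal :=
        Real.rpow_le_rpow (norm_nonneg _) (Q'.le_of_opNorm_le hn U) hp0.le

end Diagonal

/-! ### Means dominated by functionals -/

section Mean

variable {G : Type u}

/-- The bounded functions `g`, as functionals on `ℓ¹(G)`, which are real-valued and satisfy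
`0 ≤ g ≤ (Re f)⁺` pointwise. -/
def orderSegment (f : StrongDual ℂ ℓ¹(G, ℂ)) : Set (StrongDual ℂ ℓ¹(G, ℂ)) :=
  {g | ∀ t, (g (lpDelta 1 t)).im = 0 ∧ 0 ≤ (g (lpDelta 1 t)).re ∧
    (g (lpDelta 1 t)).re ≤ max (f (lpDelta 1 t)).re 0}

variable {f f' g : StrongDual ℂ ℓ¹(G, ℂ)}

lemma zero_mem_orderSegment (f : StrongDual ℂ ℓ¹(G, ℂ)) : 0 ∈ orderSegment f :=
  fun _ => ⟨rfl, le_rfl, le_max_right _ _⟩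

lemma norm_apply_of_mem_orderSegment (hg : g ∈ orderSegment f) (t : G) :
    ‖g (lpDelta 1 t)‖ ≤ max (f (lpDelta 1 t)).re 0 := by
  obtain ⟨h1, h2, h3⟩ := hg t
  rwa [← Complex.re_eq_norm.2 (Complex.nonneg_iff.2 ⟨h2, h1.symm⟩)]

lemma norm_apply_le_of_mem_orderSegment (hg : g ∈ orderSegment f) (t : G) :
    ‖g (lpDelta 1 t)‖ ≤ ‖f (lpDelta 1 t)‖ :=
  (norm_apply_of_mem_orderSegment hg t).trans (max_le (Complex.re_le_norm _) (norm_nonneg _))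

lemma norm_le_of_mem_orderSegment (hg : g ∈ orderSegment f) : ‖g‖ ≤ ‖f‖ :=
  norm_ellOne_le g (norm_nonneg f) fun t =>
    (norm_apply_le_of_mem_orderSegment hg t).trans (norm_ellOne_apply_lpDelta_le f t)

lemma smul_mem_orderSegment {c : ℝ} (hc : 0 ≤ c) (hg : g ∈ orderSegment f) :
    c • g ∈ orderSegment (c • f) := by
  intro t
  obtain ⟨h1, h2, h3⟩ := hg t
  have e (h : StrongDual ℂ ℓ¹(G, ℂ)) : (c • h) (lpDelta 1 t) = c * h (lpDelta 1 t) := rfl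
  rw [e, e, Complex.im_ofReal_mul, Complex.re_ofReal_mul, Complex.re_ofReal_mul, h1]
  refine ⟨mul_zero c, mul_nonneg hc h2, ?_⟩
  calc _ ≤ c * max (f (lpDelta 1 t)).re 0 := mul_le_mul_of_nonneg_left h3 hc
    _ = _ := by rw [mul_max_of_nonneg _ _ hc, mul_zero]

/-- The Riesz decomposition property. -/
lemma exists_add_of_mem_orderSegment (hg : g ∈ orderSegment (f + f')) :
    ∃ g₁ ∈ orderSegment f, ∃ g₂ ∈ orderSegment f', g = g₁ + g₂ := by
  have hb (t : G) : ‖((min (g (lpDelta 1 t)).re (max (f (lpDelta 1 t)).re 0) : ℝ) : ℂ)‖ ≤ ‖g‖ := by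
    obtain ⟨-, h2, -⟩ := hg t
    rw [Complex.norm_real, Real.norm_of_nonneg (le_min h2 (le_max_right _ _))]
    exact (min_le_left _ _).trans
      ((Complex.re_le_norm _).trans (norm_ellOne_apply_lpDelta_le g t))
  let g₁ : StrongDual ℂ ℓ¹(G, ℂ) := ellOneLift
    (fun t => ((min (g (lpDelta 1 t)).re (max (f (lpDelta 1 t)).re 0) : ℝ) : ℂ)) (norm_nonneg g) hb
  have hg₁ (t : G) : g₁ (lpDelta 1 t) =
      ((min (g (lpDelta 1 t)).re (max (f (lpDelta 1 t)).re 0) : ℝ) : ℂ) := ellOneLift_lpDelta _ _ _ t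
  refine ⟨g₁, fun t => ?_, g - g₁, fun t => ?_, (add_sub_cancel _ _).symm⟩
  · obtain ⟨-, h2, -⟩ := hg t
    rw [hg₁, Complex.ofReal_im, Complex.ofReal_re]
    exact ⟨rfl, le_min h2 (le_max_right _ _), min_le_right _ _⟩
  · obtain ⟨h1, h2, h3⟩ := hg t
    have e1 : (g - g₁) (lpDelta 1 t) = g (lpDelta 1 t) - g₁ (lpDelta 1 t) := rfl
    have e2 : (f + f') (lpDelta 1 t) = f (lpDelta 1 t) + f' (lpDelta 1 t) := rfl
    rw [e2, Complex.add_re] at h3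
    rw [e1, hg₁, Complex.sub_im, Complex.sub_re, Complex.ofReal_im, Complex.ofReal_re, h1]
    refine ⟨sub_zero 0, sub_nonneg.2 (min_le_left _ _), ?_⟩
    rw [sub_le_iff_le_add]
    grind

/-- The upper variation of the real part of a functional on the bounded functions, at `(Re f)⁺`. -/
noncomputable def upperVariation (M : EllOneBidual G) (f : StrongDual ℂ ℓ¹(G, ℂ)) : ℝ :=
  sSup ((fun g => (M g).re) '' orderSegment f)

variable (M : EllOneBidual G)

lemma bddAbove_upperVariation (f : StrongDual ℂ ℓ¹(G, ℂ)) :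
    BddAbove ((fun g => (M g).re) '' orderSegment f) := by
  refine ⟨‖M‖ * ‖f‖, ?_⟩
  rintro _ ⟨g, hg, rfl⟩
  exact (Complex.re_le_norm _).trans (M.le_opNorm_of_le (norm_le_of_mem_orderSegment hg))

lemma re_le_upperVariation (hg : g ∈ orderSegment f) : (M g).re ≤ upperVariation M f :=
  le_csSup (bddAbove_upperVariation M f) ⟨g, hg, rfl⟩

lemma upperVariation_le {C : ℝ} (h : ∀ g ∈ orderSegment f, (M g).re ≤ C) :
    upperVariation M f ≤ C := by
  refine csSup_le ⟨_, 0, zero_mem_orderSegment f, rfl⟩ ?_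
  rintro _ ⟨g, hg, rfl⟩
  exact h g hg

lemma upperVariation_nonneg (f : StrongDual ℂ ℓ¹(G, ℂ)) : 0 ≤ upperVariation M f := by
  simpa using re_le_upperVariation M (zero_mem_orderSegment f)

lemma re_smul_apply (c : ℝ) (g : StrongDual ℂ ℓ¹(G, ℂ)) : (M (c • g)).re = c * (M g).re := by
  have e : c • g = (c : ℂ) • g := rfl
  rw [e, map_smul, smul_eq_mul, Complex.re_ofReal_mul]

lemma upperVariation_smul {c : ℝ} (hc : 0 < c) (f : StrongDual ℂ ℓ¹(G, ℂ)) :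
    upperVariation M (c • f) = c * upperVariation M f := by
  refine le_antisymm (upperVariation_le M fun g hg => ?_) ?_
  · have h := re_le_upperVariation M (smul_mem_orderSegment (inv_nonneg.2 hc.le) hg)
    rwa [inv_smul_smul₀ hc.ne', re_smul_apply, inv_mul_le_iff₀ hc] at h
  · rw [← le_inv_mul_iff₀ hc]
    refine upperVariation_le M fun g hg => ?_
    rw [le_inv_mul_iff₀ hc, ← re_smul_apply]
    exact re_le_upperVariation M (smul_mem_orderSegment hc.le hg)

lemma upperVariation_add_le (f f' : StrongDual ℂ ℓ¹(G, ℂ)) :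
    upperVariation M (f + f') ≤ upperVariation M f + upperVariation M f' := by
  refine upperVariation_le M fun g hg => ?_
  obtain ⟨g₁, hg₁, g₂, hg₂, rfl⟩ := exists_add_of_mem_orderSegment hg
  rw [map_add, Complex.add_re]
  exact add_le_add (re_le_upperVariation M hg₁) (re_le_upperVariation M hg₂)

lemma upperVariation_nonpos (h : ∀ t, (f (lpDelta 1 t)).re ≤ 0) : upperVariation M f ≤ 0 := by
  refine upperVariation_le M fun g hg => ?_
  have hg0 : g = 0 := ellOne_ext fun t => by
    have := norm_apply_of_mem_orderSegment hg t
    rw [max_eq_right (h t)] at this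
    exact norm_le_zero_iff.1 this
  simp [hg0]

lemma upperVariation_le_mul_norm (f : StrongDual ℂ ℓ¹(G, ℂ)) :
    upperVariation M f ≤ upperVariation M (lp.tsumCLM ℂ G ℂ) * ‖f‖ := by
  refine upperVariation_le M fun g hg => ?_
  rcases eq_or_ne f 0 with rfl | hf
  · have := (re_le_upperVariation M hg).trans (upperVariation_nonpos M fun t => le_rfl)
    simpa using this
  have hf0 : 0 < ‖f‖ := norm_pos_iff.2 hf
  have hmem : ‖f‖⁻¹ • g ∈ orderSegment (lp.tsumCLM ℂ G ℂ) := by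
    intro t
    obtain ⟨h1, h2, -⟩ := hg t
    have e : (‖f‖⁻¹ • g) (lpDelta 1 t) = ((‖f‖⁻¹ : ℝ) : ℂ) * g (lpDelta 1 t) := rfl
    rw [e, Complex.im_ofReal_mul, Complex.re_ofReal_mul, h1, tsumCLM_lpDelta]
    refine ⟨mul_zero _, by positivity, le_max_of_le_left ?_⟩
    rw [inv_mul_le_iff₀ hf0, Complex.one_re, mul_one]
    exact ((Complex.re_le_norm _).trans (norm_ellOne_apply_lpDelta_le g t)).trans
      (norm_le_of_mem_orderSegment hg)
  have h := re_le_upperVariation M hmem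
  rwa [re_smul_apply, inv_mul_le_iff₀ hf0, mul_comm] at h

/-- A functional that takes the value `1` at the constant function `1` dominates, up to a factor
`2`, a mean: a positive functional below its upper variation, provided by the Hahn–Banach theorem,
and normalised. -/
theorem exists_isMean_dominated [Group G] (hM : M (lp.tsumCLM ℂ G ℂ) = 1) :
    ∃ L : EllOneBidual G, IsMean L ∧ ∀ f : StrongDual ℂ ℓ¹(G, ℂ),
      ∃ g : StrongDual ℂ ℓ¹(G, ℂ), (∀ t, ‖g (lpDelta 1 t)‖ ≤ ‖f (lpDelta 1 t)‖) ∧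
        ‖L f‖ ≤ 2 * ‖M g‖ := by
  set e : StrongDual ℂ ℓ¹(G, ℂ) := lp.tsumCLM ℂ G ℂ with he
  have het (t : G) : e (lpDelta 1 t) = 1 := tsumCLM_lpDelta t
  have he0 : e ≠ 0 := fun h => by simp [h] at hM
  set c := upperVariation M e with hc
  have hc1 : 1 ≤ c := by
    have h : e ∈ orderSegment e := fun t => by simp [het]
    simpa [hM] using re_le_upperVariation M h
  have hc0 : 0 < c := by linarith
  obtain ⟨r, hr, hrq⟩ := exists_extension_of_le_sublinear
    (LinearPMap.mkSpanSingleton (K := ℝ) e c he0) (upperVariation M)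
    (fun a ha f => upperVariation_smul M ha f) (upperVariation_add_le M) (by
      rintro ⟨x, hx⟩
      obtain ⟨a, rfl⟩ := Submodule.mem_span_singleton.1 hx
      rw [LinearPMap.mkSpanSingleton'_apply]
      rcases lt_or_ge 0 a with ha | ha
      · rw [upperVariation_smul M ha]
        rfl
      · exact (mul_nonpos_of_nonpos_of_nonneg ha hc0.le).trans (upperVariation_nonneg M _))
  have hre : r e = c := by
    rw [hr ⟨e, Submodule.mem_span_singleton_self e⟩]
    exact LinearPMap.mkSpanSingleton_apply ℝ ℝ he0 c
  have hrn (x : StrongDual ℂ ℓ¹(G, ℂ)) : |r x| ≤ c * ‖x‖ := by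
    refine abs_le'.2 ⟨(hrq x).trans (upperVariation_le_mul_norm M x), ?_⟩
    rw [← map_neg, ← norm_neg x]
    exact (hrq (-x)).trans (upperVariation_le_mul_norm M (-x))
  have hrI : r (Complex.I • e) = 0 := by
    refine le_antisymm ((hrq _).trans (upperVariation_nonpos M fun t => ?_)) ?_
    · simp [het]
    · rw [← neg_nonpos, ← map_neg]
      refine (hrq _).trans (upperVariation_nonpos M fun t => ?_)
      simp [het]
  let F : StrongDual ℂ ℓ¹(G, ℂ) →ₗ[ℂ] ℂ := Module.Dual.extendRCLike (𝕜 := ℂ) r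
  let P : Seminorm ℂ (StrongDual ℂ ℓ¹(G, ℂ)) :=
    c.toNNReal • normSeminorm ℂ (StrongDual ℂ ℓ¹(G, ℂ))
  have hP (x : StrongDual ℂ ℓ¹(G, ℂ)) : P x = c * ‖x‖ := by
    change (c.toNNReal : ℝ) * ‖x‖ = c * ‖x‖
    rw [Real.coe_toNNReal c hc0.le]
  have hFn (x : StrongDual ℂ ℓ¹(G, ℂ)) : ‖F x‖ ≤ c * ‖x‖ := by
    rw [← hP]
    exact Module.Dual.norm_extendRCLike_le_seminorm (𝕜 := ℂ) r
      (fun x => (hrn x).trans_eq (hP x).symm) x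
  have hFre (x : StrongDual ℂ ℓ¹(G, ℂ)) : (F x).re = r x :=
    Module.Dual.re_extendRCLike_apply (𝕜 := ℂ) r x
  have hFe : F e = c := by
    change (r e : ℂ) - Complex.I * (r (Complex.I • e) : ℂ) = c
    rw [hrI, hre]
    simp
  let L : EllOneBidual G := ((c⁻¹ : ℝ) : ℂ) • LinearMap.mkContinuous F c hFn
  have hL (x : StrongDual ℂ ℓ¹(G, ℂ)) : L x = ((c⁻¹ : ℝ) : ℂ) * F x := rfl
  have hLe : L e = 1 := by
    rw [hL, hFe, ← Complex.ofReal_mul, inv_mul_cancel₀ hc0.ne', Complex.ofReal_one]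
  refine ⟨L, ⟨hLe, le_antisymm ?_ ?_⟩, fun f => ?_⟩
  · refine L.opNorm_le_bound zero_le_one fun x => ?_
    rw [hL, norm_mul, Complex.norm_real, Real.norm_of_nonneg (inv_nonneg.2 hc0.le), one_mul,
      inv_mul_le_iff₀ hc0]
    exact hFn x
  · have h1 : ‖e‖ ≤ 1 := norm_ellOne_le e zero_le_one fun t => by rw [het, norm_one]
    have h2 := L.le_opNorm_of_le h1
    rwa [hLe, norm_one, mul_one] at h2
  · obtain ⟨u, hu, huf⟩ := RCLike.exists_norm_eq_mul_self (L f)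
    have h1 : ‖L f‖ ≤ upperVariation M (u • f) := by
      have h2 : (L (u • f)).re = ‖L f‖ := by
        rw [map_smul, smul_eq_mul, ← huf]
        exact Complex.ofReal_re _
      rw [← h2, hL, Complex.re_ofReal_mul, hFre]
      calc _ ≤ c⁻¹ * upperVariation M (u • f) :=
            mul_le_mul_of_nonneg_left (hrq _) (inv_nonneg.2 hc0.le)
        _ ≤ _ := mul_le_of_le_one_left (upperVariation_nonneg M _) (inv_le_one_of_one_le₀ hc1)
    rcases (upperVariation_nonneg M (u • f)).eq_or_lt with h0 | h0
    · exact ⟨0, fun t => by simp, by rw [← h0] at h1; simpa using h1⟩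
    · obtain ⟨_, ⟨g, hg, rfl⟩, hlt⟩ := exists_lt_of_lt_csSup
        (Set.Nonempty.image (fun g => (M g).re) ⟨0, zero_mem_orderSegment (u • f)⟩)
        (half_lt_self h0)
      refine ⟨g, fun t => ?_, ?_⟩
      · have h3 := norm_apply_le_of_mem_orderSegment hg t
        rwa [smul_apply, norm_smul, hu, one_mul] at h3
      · have h3 : (M g).re ≤ ‖M g‖ := Complex.re_le_norm _
        change upperVariation M (u • f) / 2 < (M g).re at hlt
        linarith

end Mean

/-! ### The mean of an equivariant splitting -/

section InjectiveToAmenable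

variable {G : Type u} [Group G]

variable (G) (p : ℝ≥0∞) [Fact (1 ≤ p)]

/-- The Banach left module of bounded operators `ℓ¹(G) → ℓ^p(G)`, with `(b · T)(a) = T(a b)`. -/
noncomputable def operatorModule : BanachLeftModule ℓ¹(G, ℂ) (ℓ¹(G, ℂ) →L[ℂ] ℓ^p(G, ℂ)) where
  act := (ContinuousLinearMap.compL ℂ ℓ¹(G, ℂ) ℓ¹(G, ℂ) ℓ^p(G, ℂ)).flip ∘L (lpConvL G 1).flip
  act_mul a b T := ContinuousLinearMap.ext fun x =>
    congrArg T (lpConv_assoc (p := 1) x a b).symm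

variable {G} {p}

lemma operatorModule_act_apply (b : ℓ¹(G, ℂ)) (T : ℓ¹(G, ℂ) →L[ℂ] ℓ^p(G, ℂ)) (a : ℓ¹(G, ℂ)) :
    (operatorModule G p).act b T a = T (lpConv a b) := rfl

/-- Injectivity splits the canonical embedding `x ↦ (a ↦ a · x)` of `ℓ^p(G)` into the operators.
In the coordinates `U t = t · T(t⁻¹)` the embedding consists of the constant families, and the
splitting is equivariant for the simultaneous translation of the argument and of the value. -/
lemma exists_equivariant_splitting (h : (ellModule G p).IsInjective) :
    ∃ Q : (ℓ¹(G, ℂ) →L[ℂ] ℓ^p(G, ℂ)) →L[ℂ] ℓ^p(G, ℂ),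
      (∀ x, Q ((lp.tsumCLM ℂ G ℂ).smulRight x) = x) ∧
      ∀ (s : G) (f : StrongDual ℂ ℓ¹(G, ℂ)) (x : ℓ^p(G, ℂ)),
        Q ((f ∘L lpTranslate 1 s⁻¹).smulRight (lpTranslate p s x)) =
          lpTranslate p s (Q (f.smulRight x)) := by
  obtain ⟨R, hR, hRid⟩ := h ℓ^p(G, ℂ) (ℓ¹(G, ℂ) →L[ℂ] ℓ^p(G, ℂ)) (ellModule G p)
    (operatorModule G p) (lpConvL G p).flip (ContinuousLinearMap.id ℂ _)
    (fun b x => ContinuousLinearMap.ext fun a => (lpConv_assoc a b x).symm)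
    ⟨ContinuousLinearMap.apply ℂ _ (lpDelta 1 1), ContinuousLinearMap.ext fun x => by
      change lpConv (lpDelta 1 1) x = x
      rw [lpConv_lpDelta, lpTranslate_one]⟩
    (fun _ _ => rfl)
  let w : G → (ℓ¹(G, ℂ) →L[ℂ] ℓ^p(G, ℂ)) →L[ℂ] ℓ^p(G, ℂ) := fun t =>
    lpTranslate p t ∘L ContinuousLinearMap.apply ℂ _ (lpDelta 1 t⁻¹)
  have hw (t : G) : ‖w t‖ ≤ 1 := by
    refine ContinuousLinearMap.opNorm_le_bound _ zero_le_one fun U => ?_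
    rw [one_mul]
    exact (norm_lpTranslate_le t _).trans (norm_ellOne_apply_lpDelta_le U _)
  let Θ := (ellOneLift w zero_le_one hw).flip
  have hΘ (U : ℓ¹(G, ℂ) →L[ℂ] ℓ^p(G, ℂ)) (t : G) :
      Θ U (lpDelta 1 t) = lpTranslate p t (U (lpDelta 1 t⁻¹)) := by
    change ellOneLift w zero_le_one hw (lpDelta 1 t) U = _
    rw [ellOneLift_lpDelta]
    rfl
  refine ⟨R ∘L Θ, fun x => ?_, fun s f x => ?_⟩
  · have h1 : Θ ((lp.tsumCLM ℂ G ℂ).smulRight x) = (lpConvL G p).flip x :=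
      ellOne_ext fun t => by
        rw [hΘ, ContinuousLinearMap.smulRight_apply, tsumCLM_lpDelta, one_smul,
          ContinuousLinearMap.flip_apply, lpConvL_apply, lpConv_lpDelta]
    change R (Θ _) = x
    rw [h1]
    exact DFunLike.congr_fun hRid x
  · have h1 : Θ ((f ∘L lpTranslate 1 s⁻¹).smulRight (lpTranslate p s x)) =
        (operatorModule G p).act (lpDelta 1 s) (Θ (f.smulRight x)) :=
      ellOne_ext fun t => by
        rw [operatorModule_act_apply, lpConv_lpDelta, lpTranslate_lpDelta, hΘ, hΘ,
          ContinuousLinearMap.smulRight_apply, ContinuousLinearMap.smulRight_apply,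
          ContinuousLinearMap.comp_apply, lpTranslate_lpDelta, mul_inv_rev, map_smul, map_smul,
          lpTranslate_mul]
    change R (Θ _) = lpTranslate p s (R (Θ _))
    rw [h1, hR, ellModule_act_lpDelta]

/-- A mean whose orbit is dominated, up to a factor `2`, by the diagonal of an operator. -/
lemma exists_isMean_dominated_by_diagonal (h : (ellModule G p).IsInjective) :
    ∃ (Q : (ℓ¹(G, ℂ) →L[ℂ] ℓ^p(G, ℂ)) →L[ℂ] ℓ^p(G, ℂ)) (L : EllOneBidual G), IsMean L ∧
      ∀ (s : G) (f : StrongDual ℂ ℓ¹(G, ℂ)), ∃ g : StrongDual ℂ ℓ¹(G, ℂ),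
        (∀ t, ‖g (lpDelta 1 t)‖ ≤ ‖f (lpDelta 1 t)‖) ∧
        ‖bidualTranslate s L f‖ ≤ 2 * ‖Q (g.smulRight (lpDelta p s)) s‖ := by
  obtain ⟨Q, hQ1, hQ⟩ := exists_equivariant_splitting h
  let M : EllOneBidual G := lp.evalCLM ℂ (fun _ : G => ℂ) p 1 ∘L Q ∘L
    (ContinuousLinearMap.smulRightL ℂ ℓ¹(G, ℂ) ℓ^p(G, ℂ)).flip (lpDelta p 1)
  have hM (f : StrongDual ℂ ℓ¹(G, ℂ)) : M f = Q (f.smulRight (lpDelta p 1)) 1 := rfl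
  obtain ⟨L, hL, hLM⟩ := exists_isMean_dominated M (by rw [hM, hQ1, lpDelta_apply_self])
  refine ⟨Q, L, hL, fun s f => ?_⟩
  obtain ⟨g, hg, hgM⟩ := hLM (f ∘L lpTranslate 1 s)
  refine ⟨g ∘L lpTranslate 1 s⁻¹, fun t => ?_, ?_⟩
  · have h1 := hg (s⁻¹ * t)
    rw [ContinuousLinearMap.comp_apply, lpTranslate_lpDelta, mul_inv_cancel_left] at h1
    rwa [ContinuousLinearMap.comp_apply, lpTranslate_lpDelta]
  · have h1 := hQ s g (lpDelta p 1)
    rw [lpTranslate_lpDelta, mul_one] at h1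
    rw [h1, lpTranslate_apply, inv_mul_cancel, ← hM]
    exact hgM

/-- The orbit of a mean dominated by the diagonal of an operator `Q` satisfies the `ℓ^p`-estimate
on tuples of bounded functions. Entries with the same translation are merged, by means of norming
vectors, so that distinct coordinates of `ℓ^p(G)` are available for the merged tuple. -/
lemma rpow_sum_orbit_le (hp' : p < ∞) {Q : (ℓ¹(G, ℂ) →L[ℂ] ℓ^p(G, ℂ)) →L[ℂ] ℓ^p(G, ℂ)}
    {L : EllOneBidual G}
    (hQ : ∀ (s : G) (f : StrongDual ℂ ℓ¹(G, ℂ)), ∃ g : StrongDual ℂ ℓ¹(G, ℂ),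
      (∀ t, ‖g (lpDelta 1 t)‖ ≤ ‖f (lpDelta 1 t)‖) ∧
      ‖bidualTranslate s L f‖ ≤ 2 * ‖Q (g.smulRight (lpDelta p s)) s‖)
    {n : ℕ} (s : Fin n → G) (f : Fin n → StrongDual ℂ ℓ¹(G, ℂ)) :
    (∑ i, ‖bidualTranslate (s i) L (f i)‖ ^ p.toReal) ^ (1 / p.toReal) ≤
      2 * ‖Q‖ * weakSummingNorm p.toReal f := by
  classical
  have hp1 : 1 ≤ p.toReal := by
    simpa using ENNReal.toReal_mono hp'.ne (Fact.out : 1 ≤ p)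
  have hp0 : 0 < p.toReal := by linarith
  set q := p.toReal
  have hnn {ι : Type} [Fintype ι] (v : ι → ℂ) : 0 ≤ ∑ i, ‖v i‖ ^ q :=
    Finset.sum_nonneg fun i _ => Real.rpow_nonneg (norm_nonneg _) _
  have hroot {ι : Type} [Fintype ι] (v : ι → ℂ) :
      ((∑ i, ‖v i‖ ^ q) ^ (1 / q)) ^ q = ∑ i, ‖v i‖ ^ q := by
    rw [one_div, Real.rpow_inv_rpow (hnn v) hp0.ne']
  set S : Finset G := Finset.univ.image s
  have hfib (F : Fin n → ℝ) : ∑ r ∈ S, ∑ i : {i // s i = r}, F i = ∑ i, F i := by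
    rw [← Finset.sum_fiberwise_of_maps_to (t := S) (g := s)
      fun i _ => Finset.mem_image_of_mem s (Finset.mem_univ i)]
    refine Finset.sum_congr rfl fun r _ => ?_
    exact (Finset.sum_subtype (Finset.univ.filter fun i => s i = r) (by simp) F).symm
  have hα (r : G) := exists_mem_lpDualBall hp1
    fun i : {i // s i = r} => bidualTranslate r L (f i)
  choose α hαmem hαeq using hα
  let m : G → StrongDual ℂ ℓ¹(G, ℂ) := fun r => ∑ i : {i // s i = r}, α r i • f i
  have hmL (r : G) : ‖bidualTranslate r L (m r)‖ ^ q =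
      ∑ i : {i // s i = r}, ‖bidualTranslate r L (f i)‖ ^ q := by
    have e : bidualTranslate r L (m r) =
        ∑ i : {i // s i = r}, α r i * bidualTranslate r L (f i) := by
      simp only [m, map_sum, map_smul, smul_eq_mul]
    rw [e, hαeq, Complex.norm_real, Real.norm_of_nonneg (Real.rpow_nonneg (hnn _) _), hroot]
  have hmt (r t : G) : ‖m r (lpDelta 1 t)‖ ^ q ≤
      ∑ i : {i // s i = r}, ‖f i (lpDelta 1 t)‖ ^ q := by
    have e : m r (lpDelta 1 t) = ∑ i : {i // s i = r}, α r i * f i (lpDelta 1 t) := by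
      simp only [m]
      rw [sum_apply]
      rfl
    rw [e, ← hroot]
    exact Real.rpow_le_rpow (norm_nonneg _) (hαmem r _) hp0.le
  choose g hg hgQ using fun r => hQ r (m r)
  let U : ℓ¹(G, ℂ) →L[ℂ] ℓ^p(G, ℂ) := ∑ r ∈ S, (g r).smulRight (lpDelta p r)
  have hUt (a : ℓ¹(G, ℂ)) : U a = ∑ r ∈ S, g r a • lpDelta p r := by
    simp only [U]
    rw [sum_apply]
    rfl
  have hU : ‖U‖ ≤ weakSummingNorm q f := by
    refine norm_ellOne_le U (weakSummingNorm_nonneg f) fun t => ?_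
    refine le_trans ?_ (rpow_sum_apply_lpDelta_le hp1 f t)
    rw [one_div, Real.le_rpow_inv_iff_of_pos (norm_nonneg _) (hnn _) hp0]
    have e : U (lpDelta 1 t) = ∑ r ∈ S, lp.single p r (g r (lpDelta 1 t)) := by
      rw [hUt]
      refine Finset.sum_congr rfl fun r _ => ?_
      have e1 := lp.single_smul (E := fun _ : G => ℂ) p r (g r (lpDelta 1 t)) (1 : ℂ)
      rw [smul_eq_mul, mul_one] at e1
      rw [e1, lpDelta]
      congr!
    rw [e, lp.norm_sum_single hp0, ← hfib]
    refine Finset.sum_le_sum fun r _ => le_trans ?_ (hmt r t)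
    exact Real.rpow_le_rpow (norm_nonneg _) (hg r t) hp0.le
  have hproj (r : G) (hr : r ∈ S) : lpCoordProj p r ∘L U = (g r).smulRight (lpDelta p r) := by
    refine ContinuousLinearMap.ext fun a => ?_
    change U a r • lpDelta p r = g r a • lpDelta p r
    congr 1
    rw [hUt, lp.coeFn_sum, Finset.sum_apply, Finset.sum_eq_single r]
    · rw [lp.coeFn_smul, Pi.smul_apply, lpDelta_apply_self, smul_eq_mul, mul_one]
    · intro r' _ h
      rw [lp.coeFn_smul, Pi.smul_apply, lpDelta_apply_of_ne p h.symm, smul_zero]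
    · exact fun h => absurd hr h
  have hmain : ∑ i, ‖bidualTranslate (s i) L (f i)‖ ^ q ≤
      (2 * ‖Q‖ * weakSummingNorm q f) ^ q := by
    calc ∑ i, ‖bidualTranslate (s i) L (f i)‖ ^ q
        = ∑ r ∈ S, ∑ i : {i // s i = r}, ‖bidualTranslate (s i) L (f i)‖ ^ q := (hfib _).symm
      _ = ∑ r ∈ S, ‖bidualTranslate r L (m r)‖ ^ q := by
        refine Finset.sum_congr rfl fun r _ => ?_
        rw [hmL]
        exact Finset.sum_congr rfl fun i _ => by rw [i.2]
      _ ≤ ∑ r ∈ S, 2 ^ q * ‖Q (lpCoordProj p r ∘L U) r‖ ^ q := by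
        refine Finset.sum_le_sum fun r hr => ?_
        rw [hproj r hr, ← Real.mul_rpow zero_le_two (norm_nonneg _)]
        exact Real.rpow_le_rpow (norm_nonneg _) (hgQ r) hp0.le
      _ ≤ 2 ^ q * (‖Q‖ * ‖U‖) ^ q := by
        rw [← Finset.mul_sum]
        exact mul_le_mul_of_nonneg_left (sum_norm_diagonal_le hp0 Q S U) (by positivity)
      _ = (2 * ‖Q‖ * ‖U‖) ^ q := by
        rw [← Real.mul_rpow zero_le_two (by positivity), mul_assoc]
      _ ≤ (2 * ‖Q‖ * weakSummingNorm q f) ^ q := by gcongr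
  rwa [one_div, Real.rpow_inv_le_iff_of_pos (hnn _)
    (mul_nonneg (by positivity) (weakSummingNorm_nonneg f)) hp0]

theorem isPQAmenable_of_isInjective (hp' : p < ∞) (h : (ellModule G p).IsInjective) :
    IsPQAmenable G p.toReal p.toReal := by
  have hp1 : 1 ≤ p.toReal := by
    simpa using ENNReal.toReal_mono hp'.ne (Fact.out : 1 ≤ p)
  obtain ⟨Q, L, hL, hQ⟩ := exists_isMean_dominated_by_diagonal h
  refine ⟨L, hL, 4 * (2 * ‖Q‖), fun n x hx => ?_⟩
  choose s hs using hx
  obtain rfl : (fun i => bidualTranslate (s i) L) = x := funext hs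
  exact weakMultiNorm_dual_le hp1 _ (by positivity) fun f => rpow_sum_orbit_le hp' hQ s f

end InjectiveToAmenable

theorem theorem5p3p10 (G : Type u) [Group G] (p : ℝ≥0∞) [Fact (1 ≤ p)] (hp : 1 < p)
    (hp' : p < ∞) :
    (ellModule G p).IsInjective ↔ IsPQAmenable G p.toReal p.toReal :=
  ⟨isPQAmenable_of_isInjective hp', isInjective_of_isPQAmenable hp'⟩
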